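/- Setting. Let $\overline C$ be a compact Riemann surface, $\Delta\subset\overline C$ finite, $C=\overline C\setminus\Delta$, and let $\mathbb V$ be a local system of rank $4$ on $C$ whose monodromies around the points of $\Delta$ have only eigenvalues of absolute value one. Let $\mathcal V$ be its Deligne extension to $\overline C$: near $c\in\Delta$, with local coordinate $q=e^{2\pi i z}$ at $c$ and monodromy $T$ acting on the space of multivalued flat sections, $\mathcal V$ is spanned over the holomorphic functions of $q$ by the sections $\exp(2\pi i\alpha z+zN_\alpha)v$, where $\alpha\in[0,1)$, $(T-e^{2\pi i\alpha})^4v=0$ and $N_\alpha=\log(e^{-2\pi i\alpha}T)$ on the generalized eigenspace (so the residue of the logarithmic connection has eigenvalues in $[0,1)$). Let $\mathcal V=F^0\supset F^1\supset F^2\supset F^3\supset F^4=0$ be a filtration by holomorphic subbundles with line bundles $E^p=F^p/F^{p+1}$ as graded pieces, satisfying Griffiths transversality $\nabla F^{p+1}\subset F^p\otimes\Omega^1_{\overline C}(\Delta)$, and assume that it is self-dual: there is a flat nondegenerate bilinear form on $\mathbb V$ for which $F^p$ and $F^{4-p}$ are orthogonal for all $p$. The Kodaira–Spencer maps are the $\mathcal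 O$-linear maps $$\tau_i\colon E^{3-i}\to E^{2-i}\otimes\Omega^1_{\overline C}(\Delta)\qquad(i=0,1,2)$$ induced by $\nabla$. Everything below concerns the germs at one point; "length" is the length of the stalk of the cokernel over the local ring of $\overline C$ there. Let $t$ be a coordinate at the point and $D=t\,\frac{d}{dt}$. Choose a local section $\omega$ of $F^3$ such that $\omega,\nabla\omega,\nabla^2\omega,\nabla^3\omega$ ($\nabla=\nabla_{d/dt}$) generate $\mathcal V$ on a punctured neighbourhood, and write $\nabla_D^4\omega+\sum_{i=0}^3Q_i\nabla_D^i\omega=0$ with $Q_i$ holomorphic at the point. The local exponents are the roots (with multiplicity) of $y^4+\sum_i Q_i(0)y^i$; they are considered up to a simultaneous shift by an integer. A point of $C$ is called regular if for some such $\omega$ one has $\nabla^4\omega+\sum_{i=0}^3P_i\nabla^i\omega=0$ with all $P_i$ holomorphic at the point. Lemma. 1. If $x\in C$ is a regular point, then $\tau_0,\tau_1,\tau_2$ are isomorphisms at $x$. 2. If $x\in C$ and the local exponents $\mu_1<\mu_2<\mu_3<\mu_4$ at $x$ are distinct integers, then the cokernels at $x$ of $\tau_0$ and of $\tau_2$ have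 length $\mu_2-\mu_1-1$, and the cokernel of $\tau_1$ has length $\mu_3-\mu_2-1$. 3. If $c\in\Delta$ and the local exponents at $c$ are real numbers $\mu_1\le\mu_2\le\mu_3\le\mu_4$, then the cokernel of $\tau_0$ at $c$ has length $\lfloor\mu_2\rfloor-\lfloor\mu_1\rfloor$, the cokernel of $\tau_1$ has length $\lfloor\mu_3\rfloor-\lfloor\mu_2\rfloor$, and the cokernel of $\tau_2$ has length $\lceil\mu_2\rceil-\lceil\mu_1\rceil$. The last number is $\lfloor\mu_2\rfloor-\lfloor\mu_1\rfloor$, the same length as for $\tau_0$, if $\mu_1,\mu_2$ are both integers or both non-integers. -/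

import Mathlib

open Filter Topology

noncomputable section

/-! ### Connections, filtrations and Kodaira–Spencer maps over a local ring

`R` is the local ring of the curve at a point, `M` a module of germs of sections. -/

/-- An additive operator on an `R`-module satisfying the Leibniz rule with respect to an operator
`d` on `R`: the covariant derivative along a vector field. -/
structure CovDeriv (R M : Type*) [CommRing R] [AddCommGroup M] [Module R M] where
  d : R → R
  toFun : M → M
  map_add : ∀ s s', toFun (s + s') = toFun s + toFun s'
  leibniz : ∀ (a : R) (s : M), toFun (a • s) = d a • s + a • toFun s

namespace CovDeriv

variable {R M : Type*} [CommRing R] [AddCommGroup M] [Module R M]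

/-- The covariant derivative along the vector field multiplied by the function `b`. -/
def smul (b : R) (D : CovDeriv R M) : CovDeriv R M where
  d a := b * D.d a
  toFun s := b • D.toFun s
  map_add s s' := by rw [D.map_add, smul_add]
  leibniz a s := by rw [D.leibniz, smul_add, smul_smul, smul_smul, smul_smul, mul_comm b a]

/-- `s` solves the differential equation `D⁴ s + ∑_{i<4} c_i D^i s = 0`. -/
def Solves (D : CovDeriv R M) (c : Fin 4 → R) (s : M) : Prop :=
  D.toFun^[4] s + ∑ i : Fin 4, c i • D.toFun^[(i : ℕ)] s = 0

/-- `s, D s, D² s, D³ s` are linearly independent germs, i.e. they generate the rank-four bundle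
at the points of a small punctured neighbourhood. -/
def Cyclic (D : CovDeriv R M) (s : M) : Prop :=
  LinearIndependent R (fun i : Fin 4 => D.toFun^[(i : ℕ)] s)

end CovDeriv

/-- The graded piece `E^p = F^p / F^{p+1}` of a decreasing filtration. -/
abbrev GrPiece {R M : Type*} [CommRing R] [AddCommGroup M] [Module R M]
    (F : ℕ → Submodule R M) (p : ℕ) : Type _ :=
  ↥(F p) ⧸ (F (p + 1)).submoduleOf (F p)

/-- (The stalk at a point of) a Hodge filtration `V = F⁰ ⊇ F¹ ⊇ F² ⊇ F³ ⊇ F⁴ = 0` by holomorphic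
subbundles whose graded pieces are line bundles, satisfying Griffiths transversality. -/
structure HodgeFiltration {R M : Type*} [CommRing R] [AddCommGroup M] [Module R M]
    (D : CovDeriv R M) (V : Submodule R M) where
  F : ℕ → Submodule R M
  F_zero : F 0 = V
  F_four : F 4 = ⊥
  anti : ∀ p, F (p + 1) ≤ F p
  free : ∀ p < 4, Module.Free R (GrPiece F p)
  rank_one : ∀ p < 4, Module.finrank R (GrPiece F p) = 1
  griffiths : ∀ p, ∀ s ∈ F (p + 1), D.toFun s ∈ F p

namespace HodgeFiltration

variable {R M : Type*} [CommRing R] [AddCommGroup M] [Module R M]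
  {D : CovDeriv R M} {V : Submodule R M}

/-- The map `F^{p+1} → F^p / F^{p+1}` induced by the covariant derivative; it is `R`-linear by
the Leibniz rule. -/
def preKS (H : HodgeFiltration D V) (p : ℕ) : ↥(H.F (p + 1)) →ₗ[R] GrPiece H.F p where
  toFun s := Submodule.Quotient.mk ⟨D.toFun s, H.griffiths p s s.2⟩
  map_add' s s' := by
    rw [← Submodule.Quotient.mk_add]
    congr 1
    exact Subtype.ext (D.map_add s s')
  map_smul' a s := by
    rw [RingHom.id_apply, ← Submodule.Quotient.mk_smul, Submodule.Quotient.eq]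
    change D.toFun (a • (s : M)) - a • D.toFun s ∈ H.F (p + 1)
    have h : D.toFun (a • (s : M)) - a • D.toFun s = D.d a • (s : M) := by
      rw [D.leibniz]; abel
    have h2 : D.d a • (s : M) ∈ H.F (p + 1) := Submodule.smul_mem _ _ s.2
    rwa [h]

/-- The Kodaira–Spencer map `E^{p+1} → E^p`, the graded piece of the Higgs field, contracted with
the vector field along which `D` derives. When this vector field generates the (logarithmic)
tangent sheaf at the point, this is `E^{p+1} → E^p ⊗ Ω¹(Δ)` in the dual generator of `Ω¹(Δ)`. -/
def kodairaSpencer (H : HodgeFiltration D V) (p : ℕ) : GrPiece H.F (p + 1) →ₗ[R] GrPiece H.F p :=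
  Submodule.liftQ _ (H.preKS p) (by
    intro s hs
    refine LinearMap.mem_ker.2 ((Submodule.Quotient.mk_eq_zero _).2 ?_)
    exact H.griffiths (p + 1) s hs)

/-- `τ₀ : E³ → E²`. -/
def tau0 (H : HodgeFiltration D V) : GrPiece H.F 3 →ₗ[R] GrPiece H.F 2 := H.kodairaSpencer 2

/-- `τ₁ : E² → E¹`. -/
def tau1 (H : HodgeFiltration D V) : GrPiece H.F 2 →ₗ[R] GrPiece H.F 1 := H.kodairaSpencer 1

/-- `τ₂ : E¹ → E⁰`. -/
def tau2 (H : HodgeFiltration D V) : GrPiece H.F 1 →ₗ[R] GrPiece H.F 0 := H.kodairaSpencer 0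

end HodgeFiltration

/-- The length of the cokernel of a linear map. -/
def cokerLength {R M N : Type*} [CommRing R] [AddCommGroup M] [Module R M]
    [AddCommGroup N] [Module R N] (f : M →ₗ[R] N) : ℕ∞ :=
  Module.length R (N ⧸ LinearMap.range f)

/-! ### Germs of holomorphic functions and of flat-frame coordinates of sections -/

/-- Filters with a basis of open sets, so that germs along them can be differentiated. -/
class OpenFilter (l : Filter ℂ) : Prop where
  interior_mem : ∀ s ∈ l, interior s ∈ l

instance : OpenFilter (𝓝 (0 : ℂ)) where
  interior_mem _ hs := interior_mem_nhds.2 hs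

/-- Neighbourhoods of `i∞`: the sets containing a half plane `{Im z > h}`, that is, the universal
cover `q = exp (2πiz)` of a punctured disc. -/
abbrev iInfty : Filter ℂ := comap Complex.im atTop

instance : OpenFilter iInfty where
  interior_mem s hs := by
    obtain ⟨t, ht, hts⟩ := mem_comap.1 hs
    obtain ⟨a, ha⟩ := mem_atTop_sets.1 ht
    refine mem_comap.2 ⟨Set.Ioi a, Ioi_mem_atTop a, ?_⟩
    refine interior_maximal ?_ (isOpen_Ioi.preimage Complex.continuous_im)
    exact fun z hz => hts (ha _ (le_of_lt hz))

theorem OpenFilter.eventuallyEq_deriv {l : Filter ℂ} [OpenFilter l] {E : Type*}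
    [NormedAddCommGroup E] [NormedSpace ℂ E] {f g : ℂ → E} (h : f =ᶠ[l] g) :
    deriv f =ᶠ[l] deriv g := by
  filter_upwards [OpenFilter.interior_mem _ h] with z hz
  exact Filter.EventuallyEq.deriv_eq (mem_interior_iff_mem_nhds.1 hz)

theorem OpenFilter.eventually_differentiableAt_deriv {l : Filter ℂ} [OpenFilter l] {E : Type*}
    [NormedAddCommGroup E] [NormedSpace ℂ E] [CompleteSpace E] {f : ℂ → E}
    (h : ∀ᶠ z in l, DifferentiableAt ℂ f z) : ∀ᶠ z in l, DifferentiableAt ℂ (deriv f) z := by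
  filter_upwards [OpenFilter.interior_mem _ h] with z hz
  have h1 : ∀ᶠ w in 𝓝 z, DifferentiableAt ℂ f w := mem_interior_iff_mem_nhds.1 hz
  exact (Complex.analyticAt_iff_eventually_differentiableAt.2 h1).deriv.differentiableAt

/-- The ring of germs of holomorphic functions along `l`. For `l = 𝓝 0` this is the local ring
`𝒪` of a curve at a point with coordinate `t = 0`. -/
def holRing (l : Filter ℂ) : Subring (Germ l ℂ) where
  carrier := {f | ∃ g : ℂ → ℂ, (∀ᶠ z in l, DifferentiableAt ℂ g z) ∧ f = (g : Germ l ℂ)}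
  mul_mem' := by
    rintro _ _ ⟨f, hf, rfl⟩ ⟨g, hg, rfl⟩
    exact ⟨f * g, by filter_upwards [hf, hg] with z h1 h2 using h1.mul h2, rfl⟩
  one_mem' := ⟨1, Eventually.of_forall fun z => differentiableAt_const (1 : ℂ), rfl⟩
  add_mem' := by
    rintro _ _ ⟨f, hf, rfl⟩ ⟨g, hg, rfl⟩
    exact ⟨f + g, by filter_upwards [hf, hg] with z h1 h2 using h1.add h2, rfl⟩
  zero_mem' := ⟨0, Eventually.of_forall fun z => differentiableAt_const (0 : ℂ), rfl⟩
  neg_mem' := by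
    rintro _ ⟨f, hf, rfl⟩
    exact ⟨-f, by filter_upwards [hf] with z h1 using h1.neg, rfl⟩

/-- The space of (multivalued) flat sections of a rank-four local system. -/
abbrev Fib := Fin 4 → ℂ

/-- Germs along `l` of holomorphic functions with values in the space of flat sections: sections
of the flat bundle, written in terms of flat sections. -/
def HolSec (l : Filter ℂ) : Submodule (holRing l) (Germ l Fib) where
  carrier := {f | ∃ g : ℂ → Fib, (∀ᶠ z in l, DifferentiableAt ℂ g z) ∧ f = (g : Germ l Fib)}
  add_mem' := by
    rintro _ _ ⟨f, hf, rfl⟩ ⟨g, hg, rfl⟩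
    exact ⟨f + g, by filter_upwards [hf, hg] with z h1 h2 using h1.add h2, rfl⟩
  zero_mem' := ⟨0, Eventually.of_forall fun z => differentiableAt_const (0 : Fib), rfl⟩
  smul_mem' := by
    rintro ⟨_, f, hf, rfl⟩ _ ⟨g, hg, rfl⟩
    exact ⟨fun z => f z • g z, by filter_upwards [hf, hg] with z h1 h2 using h1.smul h2, rfl⟩

/-- The derivative of a germ. -/
def germDeriv {l : Filter ℂ} [OpenFilter l] {E : Type*} [NormedAddCommGroup E] [NormedSpace ℂ E] :
    Germ l E → Germ l E :=
  Germ.map' deriv fun _ _ h => OpenFilter.eventuallyEq_deriv h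

theorem germDeriv_coe {l : Filter ℂ} [OpenFilter l] {E : Type*} [NormedAddCommGroup E]
    [NormedSpace ℂ E] (f : ℂ → E) : germDeriv (f : Germ l E) = ((deriv f : ℂ → E) : Germ l E) :=
  rfl

/-- The flat connection along `d/dz`: in terms of flat sections it is plain differentiation. -/
def flatConn (l : Filter ℂ) [OpenFilter l] : CovDeriv (holRing l) (HolSec l) where
  d a := ⟨germDeriv (a : Germ l ℂ), by
    obtain ⟨f, hf, h⟩ := a.2
    rw [h]
    exact ⟨deriv f, OpenFilter.eventually_differentiableAt_deriv hf, rfl⟩⟩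
  toFun s := ⟨germDeriv (s : Germ l Fib), by
    obtain ⟨f, hf, h⟩ := s.2
    rw [h]
    exact ⟨deriv f, OpenFilter.eventually_differentiableAt_deriv hf, rfl⟩⟩
  map_add := by
    rintro ⟨_, f, hf, rfl⟩ ⟨_, g, hg, rfl⟩
    refine Subtype.ext (Germ.coe_eq.2 ?_)
    filter_upwards [hf, hg] with z h1 h2 using deriv_add h1 h2
  leibniz := by
    rintro ⟨_, f, hf, rfl⟩ ⟨_, g, hg, rfl⟩
    refine Subtype.ext (Germ.coe_eq.2 ?_)
    filter_upwards [hf, hg] with z h1 h2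
    exact (deriv_fun_smul h1 h2).trans (add_comm _ _)

/-- A flat nondegenerate bilinear form for which `F^p` and `F^{4-p}` are orthogonal: the
self-duality of the filtered flat bundle. `T` is the local monodromy. -/
structure IsSelfDual {l : Filter ℂ} {R : Type*} [CommRing R] [Module R (HolSec l)]
    {D : CovDeriv R (HolSec l)} {V : Submodule R (HolSec l)} (H : HodgeFiltration D V)
    (T : Fib →ₗ[ℂ] Fib) (Q : LinearMap.BilinForm ℂ Fib) : Prop where
  nondegenerate : Q.Nondegenerate
  invariant : ∀ x y, Q (T x) (T y) = Q x y
  orthogonal : ∀ p ≤ 4, ∀ s ∈ H.F p, ∀ s' ∈ H.F (4 - p),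
    Germ.map₂ (fun x y => Q x y) (s : Germ l Fib) (s' : Germ l Fib) = ((0 : ℂ → ℂ) : Germ l ℂ)

/-- `μ₁, …, μ₄` (indexed by `0, …, 3`) are local exponents. Here `D` is the derivation along
`t d/dt` and `ev` sends an element of the local ring to its germ, whose limit is its value at
the point. There is a local section `ω` of `F³` which solves
`D⁴ ω + ∑ Q_i D^i ω = 0`, and the roots of the indicial polynomial `y⁴ + ∑ Q_i(0) y^i`,
with multiplicities, are the `μ_i` up to a simultaneous shift by an integer. -/
def IsLocalExponents {l : Filter ℂ} {R M : Type*} [CommRing R] [AddCommGroup M] [Module R M]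
    (ev : R →+* Germ l ℂ) (D : CovDeriv R M) (F3 : Submodule R M) (μ : Fin 4 → ℂ) : Prop :=
  ∃ ω ∈ F3, D.Cyclic ω ∧ ∃ Q : Fin 4 → R, D.Solves Q ω ∧
    ∃ c : Fin 4 → ℂ, (∀ i, (ev (Q i)).Tendsto (𝓝 (c i))) ∧
      ∃ k : ℤ, ∀ y : ℂ, y ^ 4 + ∑ i : Fin 4, c i * y ^ (i : ℕ) = ∏ i, (y - (μ i + k))

/-! ### Points of the open curve

`t` is a coordinate centred at the point. The local system extends over the disc, so that its
bundle is trivialised by flat sections and its stalk is `HolSec (𝓝 0)`. -/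

/-- The stalk of the flat bundle at a point of the open curve. -/
abbrev InteriorStalk := HolSec (𝓝 (0 : ℂ))

/-- `∇_{d/dt}`. -/
abbrev interiorConn : CovDeriv (holRing (𝓝 (0 : ℂ))) InteriorStalk := flatConn (𝓝 0)

/-- The coordinate `t`. -/
def interiorCoord : holRing (𝓝 (0 : ℂ)) :=
  ⟨Germ.ofFun (fun t : ℂ => t), fun t => t,
    Eventually.of_forall fun _ => differentiableAt_id, rfl⟩

/-- A filtration by Hodge subbundles near a point of the open curve. -/
abbrev InteriorHodge := HodgeFiltration interiorConn ⊤

/-- Local exponents at a point of the open curve. -/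
def InteriorHodge.Exponents (H : InteriorHodge) (μ : Fin 4 → ℂ) : Prop :=
  IsLocalExponents (holRing (𝓝 (0 : ℂ))).subtype (interiorConn.smul interiorCoord) (H.F 3) μ

/-- The point is regular: a section `ω` of `F³` whose derivatives generate satisfies
`∇⁴ ω + ∑ P_i ∇^i ω = 0`, `∇ = ∇_{d/dt}`, with `P_i` holomorphic at the point. -/
def InteriorHodge.IsRegular (H : InteriorHodge) : Prop :=
  ∃ ω ∈ H.F 3, interiorConn.Cyclic ω ∧
    ∃ P : Fin 4 → holRing (𝓝 (0 : ℂ)), interiorConn.Solves P ω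

/-! ### Cusps

`q = exp (2πiz)` is a coordinate centred at the cusp, `T` the monodromy on the space `Fib` of
multivalued flat sections. Everything is pulled back to the half plane; single-valued sections
of the flat bundle become the functions with `f (z + 1) = T (f z)`. -/

/-- The coordinate `q = exp (2πiz)`. -/
abbrev qCoord : ℂ → ℂ := Function.Periodic.qParam 1

/-- The local ring of the compactified curve at the cusp: functions `g(q)`, with `g` holomorphic
at `0`. -/
def cuspRing : Subring (holRing iInfty) where
  carrier := {h | ∃ g : ℂ → ℂ, AnalyticAt ℂ g 0 ∧
    (h : Germ iInfty ℂ) = ((fun z => g (qCoord z) : ℂ → ℂ) : Germ iInfty ℂ)}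
  mul_mem' := by
    rintro a b ⟨f, hf, h1⟩ ⟨g, hg, h2⟩
    exact ⟨f * g, hf.mul hg, by rw [Subring.coe_mul, h1, h2]; rfl⟩
  one_mem' := ⟨1, analyticAt_const, rfl⟩
  add_mem' := by
    rintro a b ⟨f, hf, h1⟩ ⟨g, hg, h2⟩
    exact ⟨f + g, hf.add hg, by rw [Subring.coe_add, h1, h2]; rfl⟩
  zero_mem' := ⟨0, analyticAt_const, rfl⟩
  neg_mem' := by
    rintro a ⟨f, hf, h1⟩
    exact ⟨-f, hf.neg, by rw [Subring.coe_neg, h1]; rfl⟩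

theorem tendsto_qCoord : Tendsto qCoord iInfty (𝓝 0) :=
  (Function.Periodic.qParam_tendsto one_pos).mono_right nhdsWithin_le_nhds

theorem deriv_qCoord (z : ℂ) : HasDerivAt qCoord (2 * Real.pi * Complex.I * qCoord z) z := by
  have h : HasDerivAt (fun z : ℂ => 2 * Real.pi * Complex.I * z / ((1 : ℝ) : ℂ))
      (2 * Real.pi * Complex.I) z := by
    simpa using (hasDerivAt_id z).const_mul (2 * Real.pi * Complex.I)
  rw [mul_comm]
  exact h.cexp

/-- `∇_D` for `D = q d/dq = (2πi)⁻¹ d/dz`, the generator of the logarithmic tangent sheaf. -/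
def cuspConn : CovDeriv cuspRing (HolSec iInfty) where
  d a := ⟨⟨(2 * Real.pi * Complex.I)⁻¹ • germDeriv ((a : holRing iInfty) : Germ iInfty ℂ), by
      obtain ⟨f, hf, h⟩ := (a : holRing iInfty).2
      rw [h]
      exact ⟨fun z => (2 * Real.pi * Complex.I)⁻¹ • deriv f z, by
        filter_upwards [OpenFilter.eventually_differentiableAt_deriv hf] with z hz
        exact hz.const_smul (2 * Real.pi * Complex.I)⁻¹, rfl⟩⟩, by
    obtain ⟨g, hg, h⟩ := a.2
    refine ⟨fun q => q * deriv g q, analyticAt_id.mul hg.deriv, ?_⟩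
    change (2 * Real.pi * Complex.I)⁻¹ • germDeriv ((a : holRing iInfty) : Germ iInfty ℂ) = _
    rw [h]
    refine Germ.coe_eq.2 ?_
    filter_upwards [tendsto_qCoord.eventually hg.eventually_analyticAt] with z hz
    have h1 := (hz.differentiableAt.hasDerivAt.comp z (deriv_qCoord z)).deriv
    change (2 * Real.pi * Complex.I)⁻¹ • deriv (g ∘ qCoord) z = _
    rw [h1, smul_eq_mul]
    field_simp [Complex.two_pi_I_ne_zero]⟩
  toFun s := ⟨(2 * Real.pi * Complex.I)⁻¹ • germDeriv (s : Germ iInfty Fib), by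
    obtain ⟨f, hf, h⟩ := s.2
    rw [h]
    exact ⟨fun z => (2 * Real.pi * Complex.I)⁻¹ • deriv f z, by
      filter_upwards [OpenFilter.eventually_differentiableAt_deriv hf] with z hz
      exact hz.const_smul (2 * Real.pi * Complex.I)⁻¹, rfl⟩⟩
  map_add s s' := by
    obtain ⟨_, f, hf, rfl⟩ := s
    obtain ⟨_, g, hg, rfl⟩ := s'
    refine Subtype.ext (Germ.coe_eq.2 ?_)
    filter_upwards [hf, hg] with z h1 h2
    change (2 * Real.pi * Complex.I)⁻¹ • deriv (f + g) z =
      (2 * Real.pi * Complex.I)⁻¹ • deriv f z + (2 * Real.pi * Complex.I)⁻¹ • deriv g z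
    rw [deriv_add h1 h2, smul_add]
  leibniz := by
    rintro ⟨⟨_, f, hf, rfl⟩, ha⟩ ⟨_, g, hg, rfl⟩
    refine Subtype.ext (Germ.coe_eq.2 ?_)
    filter_upwards [hf, hg] with z h1 h2
    change (2 * Real.pi * Complex.I)⁻¹ • deriv (fun z => f z • g z) z =
      ((2 * Real.pi * Complex.I)⁻¹ • deriv f z) • g z +
        f z • ((2 * Real.pi * Complex.I)⁻¹ • deriv g z)
    rw [deriv_fun_smul h1 h2, smul_add, add_comm, smul_assoc, smul_comm (f z)]

/-- `ζ_α = e^{2πiα}`. -/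
def zetaRoot (α : ℝ) : ℂ := Complex.exp (2 * Real.pi * Complex.I * α)

/-- `W_α`, the generalised eigenspace of the monodromy for `ζ_α`. -/
def monodromyEigen (T : Fib →ₗ[ℂ] Fib) (α : ℝ) : Submodule ℂ Fib :=
  LinearMap.ker ((T - zetaRoot α • (1 : Module.End ℂ Fib) : Module.End ℂ Fib) ^ 4)

/-- `N_α = log (ζ_α⁻¹ T)` on `W_α`, where `ζ_α⁻¹ T` is unipotent so that the logarithm series
terminates. -/
def monodromyLog (T : Fib →ₗ[ℂ] Fib) (α : ℝ) : Module.End ℂ Fib :=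
  ∑ k ∈ Finset.Icc (1 : ℕ) 3, ((-1 : ℂ) ^ (k + 1) / (k : ℂ)) •
    (((zetaRoot α)⁻¹ • T - 1 : Module.End ℂ Fib) ^ k)

/-- The section `exp (2πiαz + z N_α) v` for `v ∈ W_α`; there `N_α` is nilpotent, so that the
exponential series of `z N_α` terminates. -/
def deligneSection (T : Fib →ₗ[ℂ] Fib) (α : ℝ) (v : Fib) (z : ℂ) : Fib :=
  Complex.exp (2 * Real.pi * Complex.I * α * z) •
    ∑ j ∈ Finset.range 4, (z ^ j / (j.factorial : ℂ)) • (monodromyLog T α ^ j) v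

theorem differentiable_deligneSection (T : Fib →ₗ[ℂ] Fib) (α : ℝ) (v : Fib) :
    Differentiable ℂ (deligneSection T α v) := by
  unfold deligneSection
  fun_prop

/-- The stalk at the cusp of the Deligne extension: the module over the local ring spanned by
the sections `exp (2πiαz + z N_α) v`, `α ∈ [0,1)`, `v ∈ W_α`. -/
def deligneExtension (T : Fib →ₗ[ℂ] Fib) : Submodule cuspRing (HolSec iInfty) :=
  Submodule.span cuspRing {s | ∃ α : ℝ, 0 ≤ α ∧ α < 1 ∧ ∃ v ∈ monodromyEigen T α,
    (s : Germ iInfty Fib) = (deligneSection T α v : Germ iInfty Fib)}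

/-- All eigenvalues of the monodromy around the cusp have absolute value one. -/
def NonExpanding (T : Fib →ₗ[ℂ] Fib) : Prop :=
  ∀ z : ℂ, Module.End.HasEigenvalue T z → ‖z‖ = 1

/-- A filtration by Hodge subbundles of the Deligne extension near a cusp. -/
abbrev CuspHodge (T : Fib →ₗ[ℂ] Fib) := HodgeFiltration cuspConn (deligneExtension T)

/-- Local exponents at a cusp. -/
def CuspHodge.Exponents {T : Fib →ₗ[ℂ] Fib} (H : CuspHodge T) (μ : Fin 4 → ℂ) : Prop :=
  IsLocalExponents ((holRing iInfty).subtype.comp cuspRing.subtype) cuspConn (H.F 3) μ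

end

/-! Everything is read off from a logarithmic connection D (`t∇` at a point of C, `q d/dq` at a
cusp) that preserves the lattice V and whose residue on V has eigenvalues in [0,1). At a point of C,
V has a flat frame and the residue is 0; at a cusp, V is spanned by Jordan chains of D with
eigenvalues α in [0,1).

In a frame e_3, e_2, e_1, e_0 adapted to the filtration, Kodaira–Spencer is multiplication by a
function a_p, so each cokernel length is the order of some a_p. For ω = f e_3, rescaling the frame
by f, f a_2, f a_2 a_1, f a_2 a_1 a_0 turns the connection matrix into a Hessenberg matrix with 1
below the diagonal. The indicial polynomial is the characteristic polynomial of its value at the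
point. Rescaling adds to the diagonal the orders m, m+n0, m+n0+n1, m+n0+n1+n2 of the scaling
functions. Where n_p > 0 the matrix splits into blocks, and where n_p = 0 both neighbours get the
same shift. Hence the exponents are residue eigenvalues shifted by these integers, and the n_p are
the gaps between consecutive floors (`HodgeFrame.exists_indicial_roots`).

Self-duality relates τ_2 to τ_0. The Yukawa coupling Y = B(ω, D³ω) is nonzero and satisfies 2DY =
-Q_3 Y; differentiating the orthogonality relations makes the indicial polynomial symmetric under y
↦ r - y (`FlatPairing.yukawa`, `add_eq_of_symmetric`). So μ_1 + μ_4 = μ_2 + μ_3. At a cusp Y is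
moreover single-valued, which makes this sum an integer and turns the floor gap of μ_3, μ_4 into the
ceiling gap of μ_1, μ_2. At a point of C, passing from `∇` to `t∇` costs one order in each a_p,
whence the -1.

At a regular point the span of ω, …, ∇³ω is ∇-stable and contains some t^n V. Differentiating t^n v
for flat v shows that it is all of V, which forces every a_p to be a unit. -/

noncomputable section

open scoped Matrix

/-! ### Hessenberg polynomials -/

/-- The determinant of the Hessenberg matrix with diagonal `d`, superdiagonal part `-h` and
subdiagonal entries `-1`. -/
def hessenbergDet (d0 d1 d2 d3 h01 h12 h23 h02 h13 h03 : ℂ) : ℂ :=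
  d3 * (d2 * (d1 * d0 - h01) - h12 * d0 - h02) - h23 * (d1 * d0 - h01) - h13 * d0 - h03

theorem exists_roots_quadratic (p q : ℂ) : ∃ r s : ℂ, ∀ y : ℂ,
    y ^ 2 + p * y + q = (y - r) * (y - s) := by
  obtain ⟨w, hw⟩ := IsAlgClosed.exists_eq_mul_self (p ^ 2 - 4 * q)
  refine ⟨(-p + w) / 2, (-p - w) / 2, fun y => ?_⟩
  linear_combination (-1 / 4) * hw

theorem exists_roots_of_monic {n : ℕ} {P : Polynomial ℂ} (hP : P.Monic) (hd : P.natDegree = n) :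
    ∃ r : Fin n → ℂ, ∀ y, P.eval y = ∏ i, (y - r i) := by
  have hs := IsAlgClosed.splits P
  have hc : P.roots.toList.length = n := by
    rw [Multiset.length_toList, ← hd, hs.natDegree_eq_card_roots]
  refine ⟨fun i => P.roots.toList.get (i.cast hc.symm), fun y => ?_⟩
  have h1 : P.eval y = (P.roots.map (fun a => y - a)).prod := by
    rw [hs.eval_eq_prod_roots_of_monic hP]
  rw [h1]
  conv_lhs => rw [← Multiset.coe_toList P.roots]
  rw [Multiset.map_coe, Multiset.prod_coe]
  subst hc
  rw [← List.prod_ofFn]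
  congr 1
  apply List.ext_get <;> simp

theorem exists_roots_cubic (a b c : ℂ) : ∃ r s t : ℂ, ∀ y : ℂ,
    y ^ 3 + a * y ^ 2 + b * y + c = (y - r) * (y - s) * (y - t) := by
  have hm : (Polynomial.X ^ 3 + Polynomial.C a * Polynomial.X ^ 2 + Polynomial.C b * Polynomial.X
      + Polynomial.C c : Polynomial ℂ).Monic := by monicity!
  obtain ⟨r, hr⟩ := exists_roots_of_monic (n := 3) hm (by compute_degree!)
  refine ⟨r 0, r 1, r 2, fun y => ?_⟩
  simpa [Fin.prod_univ_three] using hr y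

theorem exists_roots_quartic (a b c d : ℂ) : ∃ r s t v : ℂ, ∀ y : ℂ,
    y ^ 4 + a * y ^ 3 + b * y ^ 2 + c * y + d = (y - r) * (y - s) * (y - t) * (y - v) := by
  have hm : (Polynomial.X ^ 4 + Polynomial.C a * Polynomial.X ^ 3 + Polynomial.C b * Polynomial.X ^ 2
      + Polynomial.C c * Polynomial.X + Polynomial.C d : Polynomial ℂ).Monic := by monicity!
  obtain ⟨r, hr⟩ := exists_roots_of_monic (n := 4) hm (by compute_degree!)
  refine ⟨r 0, r 1, r 2, r 3, fun y => ?_⟩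
  simpa [Fin.prod_univ_four] using hr y

/-- Shifting the diagonal of a block triangular Hessenberg matrix by block constants shifts its
eigenvalues. -/
theorem exists_roots_hessenbergDet (x0 x1 x2 x3 a0 a1 a2 u01 u12 u23 u02 u13 u03 : ℂ)
    (m n0 n1 n2 : ℕ) (h0 : n0 = 0 ∨ a0 = 0) (h1 : n1 = 0 ∨ a1 = 0) (h2 : n2 = 0 ∨ a2 = 0) :
    ∃ r : Fin 4 → ℂ,
      (∀ y, hessenbergDet (y - x0) (y - x1) (y - x2) (y - x3) (a0 * u01) (a1 * u12) (a2 * u23)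
        (a0 * a1 * u02) (a1 * a2 * u13) (a0 * a1 * a2 * u03) = ∏ i, (y - r i)) ∧
      ∀ y, hessenbergDet (y - (m + x0)) (y - (m + n0 + x1)) (y - (m + n0 + n1 + x2))
        (y - (m + n0 + n1 + n2 + x3)) (a0 * u01) (a1 * u12) (a2 * u23)
        (a0 * a1 * u02) (a1 * a2 * u13) (a0 * a1 * a2 * u03) =
          (y - (m + r 0)) * (y - (m + n0 + r 1)) * (y - (m + n0 + n1 + r 2)) *
            (y - (m + n0 + n1 + n2 + r 3)) := by
  unfold hessenbergDet
  -- Where a_p = 0, all products containing a_p vanish and the determinant factors there; where n_p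
  -- = 0, the two adjacent diagonal entries carry the same shift. In each of the eight cases the
  -- polynomial is a product over blocks, each evaluated at y minus its own shift.
  rcases h0 with rfl | rfl <;> rcases h1 with rfl | rfl <;> rcases h2 with rfl | rfl
  · obtain ⟨r, s, t, v, h⟩ := exists_roots_quartic (-(x0 + x1 + x2 + x3))
      (x0 * x1 + x0 * x2 + x0 * x3 + x1 * x2 + x1 * x3 + x2 * x3 - a0 * u01 - a1 * u12 - a2 * u23)
      (-(x0 * x1 * x2 + x0 * x1 * x3 + x0 * x2 * x3 + x1 * x2 * x3) + a0 * u01 * (x2 + x3)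
        + a1 * u12 * (x0 + x3) + a2 * u23 * (x0 + x1) - a0 * a1 * u02 - a1 * a2 * u13)
      (x0 * x1 * x2 * x3 - a0 * u01 * x2 * x3 - a1 * u12 * x0 * x3 - a2 * u23 * x0 * x1
        + a0 * u01 * (a2 * u23) + a0 * a1 * u02 * x3 + a1 * a2 * u13 * x0 - a0 * a1 * a2 * u03)
    refine ⟨![r, s, t, v], fun y => ?_, fun y => ?_⟩
    · simp only [Fin.prod_univ_four, Matrix.cons_val]
      linear_combination h y
    · simp only [Matrix.cons_val, Nat.cast_zero]
      linear_combination h (y - m)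
  · obtain ⟨r, s, t, h⟩ := exists_roots_cubic (-(x0 + x1 + x2))
      (x0 * x1 + x0 * x2 + x1 * x2 - a0 * u01 - a1 * u12)
      (-(x0 * x1 * x2) + a0 * u01 * x2 + a1 * u12 * x0 - a0 * a1 * u02)
    refine ⟨![r, s, t, x3], fun y => ?_, fun y => ?_⟩
    · simp only [Fin.prod_univ_four, Matrix.cons_val]
      linear_combination (y - x3) * h y
    · simp only [Matrix.cons_val, Nat.cast_zero]
      linear_combination (y - (m + n2 + x3)) * h (y - m)
  · obtain ⟨r, s, h⟩ := exists_roots_quadratic (-(x0 + x1)) (x0 * x1 - a0 * u01)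
    obtain ⟨t, v, h'⟩ := exists_roots_quadratic (-(x2 + x3)) (x2 * x3 - a2 * u23)
    refine ⟨![r, s, t, v], fun y => ?_, fun y => ?_⟩
    · simp only [Fin.prod_univ_four, Matrix.cons_val]
      linear_combination (y ^ 2 + -(x2 + x3) * y + (x2 * x3 - a2 * u23)) * h y +
        (y - r) * (y - s) * h' y
    · simp only [Matrix.cons_val, Nat.cast_zero]
      linear_combination ((y - m - n1) ^ 2 + -(x2 + x3) * (y - m - n1) + (x2 * x3 - a2 * u23)) *
        h (y - m) + (y - m - r) * (y - m - s) * h' (y - m - n1)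
  · obtain ⟨r, s, h⟩ := exists_roots_quadratic (-(x0 + x1)) (x0 * x1 - a0 * u01)
    refine ⟨![r, s, x2, x3], fun y => ?_, fun y => ?_⟩
    · simp only [Fin.prod_univ_four, Matrix.cons_val]
      linear_combination (y - x2) * (y - x3) * h y
    · simp only [Matrix.cons_val, Nat.cast_zero]
      linear_combination (y - (m + n1 + x2)) * (y - (m + n1 + n2 + x3)) * h (y - m)
  · obtain ⟨r, s, t, h⟩ := exists_roots_cubic (-(x1 + x2 + x3))
      (x1 * x2 + x1 * x3 + x2 * x3 - a1 * u12 - a2 * u23)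
      (-(x1 * x2 * x3) + a1 * u12 * x3 + a2 * u23 * x1 - a1 * a2 * u13)
    refine ⟨![x0, r, s, t], fun y => ?_, fun y => ?_⟩
    · simp only [Fin.prod_univ_four, Matrix.cons_val]
      linear_combination (y - x0) * h y
    · simp only [Matrix.cons_val, Nat.cast_zero]
      linear_combination (y - (m + x0)) * h (y - m - n0)
  · obtain ⟨r, s, h⟩ := exists_roots_quadratic (-(x1 + x2)) (x1 * x2 - a1 * u12)
    refine ⟨![x0, r, s, x3], fun y => ?_, fun y => ?_⟩
    · simp only [Fin.prod_univ_four, Matrix.cons_val]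
      linear_combination (y - x0) * (y - x3) * h y
    · simp only [Matrix.cons_val, Nat.cast_zero]
      linear_combination (y - (m + x0)) * (y - (m + n0 + n2 + x3)) * h (y - m - n0)
  · obtain ⟨r, s, h⟩ := exists_roots_quadratic (-(x2 + x3)) (x2 * x3 - a2 * u23)
    refine ⟨![x0, x1, r, s], fun y => ?_, fun y => ?_⟩
    · simp only [Fin.prod_univ_four, Matrix.cons_val]
      linear_combination (y - x0) * (y - x1) * h y
    · simp only [Matrix.cons_val, Nat.cast_zero]
      linear_combination (y - (m + x0)) * (y - (m + n0 + x1)) * h (y - m - n0 - n1)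
  · refine ⟨![x0, x1, x2, x3], fun y => ?_, fun y => ?_⟩
    · simp only [Fin.prod_univ_four, Matrix.cons_val]
      ring
    · simp only [Matrix.cons_val]
      ring

theorem det_hessenberg (y : ℂ) (x0 x1 x2 x3 a0 a1 a2 u01 u12 u23 u02 u13 u03 : ℂ) :
    (!![x0, u01, u02, u03; a0, x1, u12, u13; 0, a1, x2, u23; 0, 0, a2, x3] -
      y • (1 : Matrix (Fin 4) (Fin 4) ℂ)).det =
      hessenbergDet (y - x0) (y - x1) (y - x2) (y - x3) (a0 * u01) (a1 * u12) (a2 * u23)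
        (a0 * a1 * u02) (a1 * a2 * u13) (a0 * a1 * a2 * u03) := by
  unfold hessenbergDet
  simp [Matrix.det_succ_row_zero, Fin.sum_univ_succ, Matrix.one_apply, Fin.succAbove,
    Matrix.submatrix_apply]
  ring

/-- The annihilating polynomial of the cyclic vector of a Hessenberg matrix is its
characteristic polynomial. -/
theorem hessenbergDet_eq_of_cyclic (x0 x1 x2 x3 h01 h12 h23 h02 h13 h03 : ℂ) (c : Fin 4 → ℂ)
    (X : ℕ → Fin 4 → ℂ) (h0 : X 0 = ![1, 0, 0, 0])
    (hX : ∀ k, X (k + 1) = ![x0 * X k 0 + h01 * X k 1 + h02 * X k 2 + h03 * X k 3,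
      X k 0 + x1 * X k 1 + h12 * X k 2 + h13 * X k 3, X k 1 + x2 * X k 2 + h23 * X k 3,
      X k 2 + x3 * X k 3])
    (h : X 4 + ∑ i : Fin 4, c i • X i = 0) (y : ℂ) :
    y ^ 4 + ∑ i : Fin 4, c i * y ^ (i : ℕ) =
      hessenbergDet (y - x0) (y - x1) (y - x2) (y - x3) h01 h12 h23 h02 h13 h03 := by
  have e0 := congrFun h 0
  have e1 := congrFun h 1
  have e2 := congrFun h 2
  have e3 := congrFun h 3
  simp [Fin.sum_univ_four, hX, h0] at e0 e1 e2 e3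
  unfold hessenbergDet
  simp only [Fin.sum_univ_four, Fin.val_zero, Fin.val_one, Fin.val_two]
  change y ^ 4 + (_ + _ + _ + c 3 * y ^ 3) = _
  -- The coefficients p = (1, p_1, p_2, p_3) are the leading principal minors of y - A. They satisfy
  -- pA = yp - (0, 0, 0, det(y - A)), so p·X_k = y^k for k ≤ 3 and p·X_4 = y⁴ - det(y - A); pairing
  -- the relation with p gives the claim.
  linear_combination e0 + (y - x0) * e1 + ((y - x1) * (y - x0) - h01) * e2 +
    ((y - x2) * ((y - x1) * (y - x0) - h01) - h12 * (y - x0) - h02) * e3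

/-! ### Comparing sorted families of roots -/

theorem map_univ_eq_of_prod_eq {n : ℕ} {f g : Fin n → ℂ}
    (h : ∀ y : ℂ, ∏ i, (y - f i) = ∏ i, (y - g i)) :
    (Finset.univ.val.map f : Multiset ℂ) = Finset.univ.val.map g := by
  have hp : (∏ i, (Polynomial.X - Polynomial.C (f i)) : Polynomial ℂ) =
      ∏ i, (Polynomial.X - Polynomial.C (g i)) := by
    refine Polynomial.funext fun y => ?_
    simpa [Polynomial.eval_prod] using h y
  have key : ∀ f : Fin n → ℂ, (∏ i, (Polynomial.X - Polynomial.C (f i)) : Polynomial ℂ).roots =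
      Finset.univ.val.map f := by
    intro f
    rw [← Polynomial.roots_multiset_prod_X_sub_C (Finset.univ.val.map f), Multiset.map_map]
    rfl
  rw [← key f, ← key g, hp]

theorem eq_of_monotone_of_map_univ_eq {n : ℕ} {α : Type*} [LinearOrder α] {f g : Fin n → α}
    (hf : Monotone f) (hg : Monotone g)
    (h : (Finset.univ.val.map f : Multiset α) = Finset.univ.val.map g) : f = g := by
  have e : ∀ f : Fin n → α, (Finset.univ.val.map f : Multiset α) = (List.ofFn f : Multiset α) := by
    intro f
    rw [Fin.univ_val_map]
  rw [e, e, Multiset.coe_eq_coe] at h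
  exact List.ofFn_injective (h.eq_of_pairwise' (List.pairwise_ofFn.2 fun i j hij => hf hij.le)
    (List.pairwise_ofFn.2 fun i j hij => hg hij.le))

/-- Real sorted families with the same monic polynomial agree. -/
theorem eq_of_monotone_of_prod_eq {n : ℕ} {f g : Fin n → ℝ} (hf : Monotone f) (hg : Monotone g)
    (h : ∀ y : ℂ, ∏ i, (y - f i) = ∏ i, (y - g i)) : f = g := by
  refine eq_of_monotone_of_map_univ_eq hf hg ?_
  have := congrArg (Multiset.map Complex.re) (map_univ_eq_of_prod_eq h)
  simpa [Multiset.map_map, Function.comp_def] using this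

/-- If the monic polynomials with roots `f` and `b + r` agree, where `0 ≤ r < 1`, then the integral
parts of the sorted family `f` are the sorted family `b`. -/
theorem floor_eq_of_prod_eq {n : ℕ} {f r : Fin n → ℝ} {b : Fin n → ℤ} (hf : Monotone f)
    (hb : Monotone b) (hr0 : ∀ i, 0 ≤ r i) (hr1 : ∀ i, r i < 1)
    (h : ∀ y : ℂ, ∏ i, (y - f i) = ∏ i, (y - (b i + r i))) (i : Fin n) : ⌊f i⌋ = b i := by
  have h1 := congrArg (Multiset.map fun z : ℂ => ⌊z.re⌋) (map_univ_eq_of_prod_eq h)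
  simp only [Multiset.map_map, Function.comp_def, Complex.ofReal_re, Complex.add_re,
    Complex.intCast_re, Int.floor_intCast_add] at h1
  have h2 : ∀ i, b i + ⌊r i⌋ = b i := fun i => by
    rw [Int.floor_eq_zero_iff.2 ⟨hr0 i, hr1 i⟩, add_zero]
  simp only [h2] at h1
  exact congrFun (eq_of_monotone_of_map_univ_eq
    (f := fun i => ⌊f i⌋) (fun i j hij => Int.floor_mono (hf hij)) hb h1) i

/-- By `h3`, r is half the sum of the roots. The difference of the quartic at y and at r - y is (y -
r/2)/4 times the left side of `h1`, so the root multiset is stable under y ↦ r - y. This reverses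
the order, hence pairs the smallest root with the largest. -/
theorem add_eq_of_symmetric {μ : Fin 4 → ℝ} (hμ : Monotone μ) {k r : ℝ} {c : Fin 4 → ℂ}
    (h : ∀ y : ℂ, y ^ 4 + ∑ i : Fin 4, c i * y ^ (i : ℕ) = ∏ i, (y - (μ i + k)))
    (h3 : c 3 = -2 * r) (h1 : 8 * c 1 + (c 3 ^ 2 - 4 * c 2) * c 3 = 0) :
    μ 0 + μ 3 + 2 * k = r ∧ μ 1 + μ 2 + 2 * k = r := by
  have hs : ∀ y : ℂ, ∏ i, (y - ((μ i + k : ℝ) : ℂ)) =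
      ∏ i, (y - ((r - (μ (Fin.rev i) + k) : ℝ) : ℂ)) := by
    intro y
    have e1 := h y
    have e2 := h (r - y)
    have e3 : ∏ i, (y - ((r - (μ (Fin.rev i) + k) : ℝ) : ℂ)) = ∏ i, ((r - y) - (μ i + k : ℂ)) := by
      simp only [Fin.prod_univ_four, Fin.rev, Complex.ofReal_sub, Complex.ofReal_add]
      simp
      ring
    rw [e3, ← e2]
    push_cast
    rw [← e1]
    simp only [Fin.sum_univ_four, Fin.val_zero, Fin.val_one, Fin.val_two]
    change y ^ 4 + (_ + _ + _ + c 3 * y ^ 3) = (r - y) ^ 4 + (_ + _ + _ + c 3 * (r - y) ^ 3)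
    rw [h3] at h1 ⊢
    linear_combination (y / 4 - r / 8) * h1
  have hg : Monotone fun i => r - (μ (Fin.rev i) + k) := fun i j hij => by
    have := hμ (Fin.rev_le_rev.2 hij)
    dsimp only
    linarith
  have e := eq_of_monotone_of_prod_eq (f := fun i => μ i + k)
    (fun i j hij => by simpa using hμ hij) hg hs
  have a := congrFun e 0
  have b := congrFun e 1
  simp [Fin.rev] at a b
  constructor <;> linarith

/-! ### Local rings with a logarithmic derivation -/

/-- A ring behaving like the local ring of a curve at a point, with value map `ev`, uniformiser `t`
and derivation `d` behaving like `t d/dt`. -/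
structure LogLocal (R : Type*) [CommRing R] (d : R → R) where
  ev : R →+* ℂ
  t : R
  d_mul : ∀ a b, d (a * b) = d a * b + a * d b
  d_t : d t = t
  ev_d : ∀ a, ev (d a) = 0
  isUnit_of_ev : ∀ a, ev a ≠ 0 → IsUnit a
  ev_t : ev t = 0
  t_pow_ne : ∀ n : ℕ, t ^ n ≠ 0
  factor : ∀ a ≠ 0, ∃ (n : ℕ) (u : R), IsUnit u ∧ a = t ^ n * u

namespace LogLocal

variable {R : Type*} [CommRing R] {d : R → R} (L : LogLocal R d)

include L in
theorem isDomain : IsDomain R := by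
  have : Nontrivial R := ⟨1, 0, by simpa using L.t_pow_ne 0⟩
  have : NoZeroDivisors R := by
    refine ⟨fun {a b} hab => ?_⟩
    by_contra! h
    obtain ⟨n, u, hu, rfl⟩ := L.factor a h.1
    obtain ⟨m, v, hv, rfl⟩ := L.factor b h.2
    have h1 : L.t ^ (n + m) * (u * v) = 0 := by rw [← hab]; ring
    exact L.t_pow_ne (n + m) ((hu.mul hv).mul_left_eq_zero.1 h1)
  exact NoZeroDivisors.to_isDomain R

theorem dvd_of_ev_eq_zero {a : R} (h : L.ev a = 0) : L.t ∣ a := by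
  by_cases ha : a = 0
  · simp [ha]
  obtain ⟨n, u, hu, rfl⟩ := L.factor a ha
  cases n with
  | zero => simp [(hu.map L.ev).ne_zero] at h
  | succ n => exact ⟨L.t ^ n * u, by ring⟩

/-- An element outside (t) has nonzero value and is therefore a unit, so (t) is maximal. -/
theorem ord_t : Ring.ord R L.t = 1 := by
  rw [Ring.ord, Module.length_eq_one_iff, isSimpleModule_iff_isCoatom, ← Ideal.isMaximal_def]
  refine Ideal.isMaximal_iff.2 ⟨fun h => ?_, fun J x _ hx hxJ => ?_⟩
  · obtain ⟨a, ha⟩ := Ideal.mem_span_singleton'.1 h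
    simpa [L.ev_t] using congrArg L.ev ha
  · have hu : IsUnit x := L.isUnit_of_ev x fun h =>
      hx (Ideal.mem_span_singleton.2 (L.dvd_of_ev_eq_zero h))
    rw [J.eq_top_of_isUnit_mem hxJ hu]
    trivial

theorem ord_eq (n : ℕ) {u : R} (hu : IsUnit u) : Ring.ord R (L.t ^ n * u) = n := by
  have := L.isDomain
  rw [Ring.ord_mul_of_isUnit_right hu, Ring.ord_pow _, L.ord_t, nsmul_one]
  exact mem_nonZeroDivisors_of_ne_zero (by simpa using L.t_pow_ne 1)

/-- The logarithmic derivative of t^n u is n + d(u)/u, and `d` takes values vanishing at the point.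
This is the source of the integer shifts on the diagonal of the rescaled connection matrix. -/
theorem exists_logDeriv (n : ℕ) {u : R} (hu : IsUnit u) :
    ∃ l, d (L.t ^ n * u) = l * (L.t ^ n * u) ∧ L.ev l = n := by
  have h1 : d 1 = 0 := by simpa using L.d_mul 1 1
  have hn : ∀ n : ℕ, d (L.t ^ n) = n * L.t ^ n := by
    intro n
    induction n with
    | zero => simp [h1]
    | succ n ih => rw [pow_succ, L.d_mul, ih, L.d_t]; push_cast; ring
  obtain ⟨u, rfl⟩ := hu
  refine ⟨n + d u * (u⁻¹ : Rˣ), ?_, by simp [L.ev_d]⟩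
  rw [L.d_mul, hn]
  linear_combination (-(d u * L.t ^ n)) * u.inv_mul

end LogLocal

/-! ### Hodge frames -/

/-- A basis adapted to a Hodge filtration, with the matrix entries of the Kodaira–Spencer maps. -/
structure HodgeFrame {R M : Type*} [CommRing R] [AddCommGroup M] [Module R M]
    (D : CovDeriv R M) (F : ℕ → Submodule R M) where
  e : ℕ → M
  mem : ∀ p < 4, e p ∈ F p
  gen : ∀ p < 4, ∀ x ∈ F p, ∃ r : R, x - r • e p ∈ F (p + 1)
  indep : ∀ p < 4, ∀ r : R, r • e p ∈ F (p + 1) → r = 0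
  a : ℕ → R
  a_spec : ∀ p < 3, D.toFun (e (p + 1)) - a p • e p ∈ F (p + 1)

namespace HodgeFiltration

variable {R M : Type*} [CommRing R] [AddCommGroup M] [Module R M]
  {D : CovDeriv R M} {V : Submodule R M}

theorem exists_frame [Nontrivial R] (H : HodgeFiltration D V) : Nonempty (HodgeFrame D H.F) := by
  have h : ∀ p : ℕ, ∃ e : M, p < 4 → e ∈ H.F p ∧
      (∀ x ∈ H.F p, ∃ r : R, x - r • e ∈ H.F (p + 1)) ∧ ∀ r : R, r • e ∈ H.F (p + 1) → r = 0 := by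
    intro p
    by_cases hp : p < 4
    · have := H.free p hp
      have : Module.Finite R (GrPiece H.F p) :=
        Module.finite_of_finrank_pos (by rw [H.rank_one p hp]; exact one_pos)
      let b := Module.finBasisOfFinrankEq R (GrPiece H.F p) (H.rank_one p hp)
      obtain ⟨e, he⟩ := Submodule.Quotient.mk_surjective _ (b 0)
      refine ⟨e, fun _ => ⟨e.2, fun x hx => ?_, fun r hr => ?_⟩⟩
      · refine ⟨b.repr (Submodule.Quotient.mk ⟨x, hx⟩) 0, ?_⟩
        have h1 := b.sum_repr (Submodule.Quotient.mk ⟨x, hx⟩)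
        rw [Fin.sum_univ_one, ← he, ← Submodule.Quotient.mk_smul, eq_comm,
          Submodule.Quotient.eq] at h1
        exact h1
      · have h1 : (Submodule.Quotient.mk (r • e) : GrPiece H.F p) = 0 :=
          (Submodule.Quotient.mk_eq_zero _).2 hr
        rw [Submodule.Quotient.mk_smul, he] at h1
        have h2 := congrArg (fun z => b.repr z 0) h1
        simpa using h2
    · exact ⟨0, fun h => absurd h hp⟩
  choose e he using h
  have ha : ∀ p : ℕ, ∃ a : R, p < 3 → D.toFun (e (p + 1)) - a • e p ∈ H.F (p + 1) := by
    intro p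
    by_cases hp : p < 3
    · obtain ⟨a, ha⟩ := (he p (by omega)).2.1 _ (H.griffiths p _ (he (p + 1) (by omega)).1)
      exact ⟨a, fun _ => ha⟩
    · exact ⟨0, fun h => absurd h hp⟩
  choose a ha using ha
  exact ⟨⟨e, fun p hp => (he p hp).1, fun p hp => (he p hp).2.1, fun p hp => (he p hp).2.2, a, ha⟩⟩

/-- The isomorphism `E^p ≃ R` given by a frame. -/
theorem exists_equiv (H : HodgeFiltration D V) (fr : HodgeFrame D H.F) {p : ℕ} (hp : p < 4) :
    ∃ φ : R ≃ₗ[R] GrPiece H.F p, ∀ r, φ r = r • Submodule.Quotient.mk ⟨fr.e p, fr.mem p hp⟩ := by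
  refine ⟨LinearEquiv.ofBijective (LinearMap.toSpanSingleton R _
    (Submodule.Quotient.mk ⟨fr.e p, fr.mem p hp⟩)) ⟨?_, ?_⟩, fun r => rfl⟩
  · refine (injective_iff_map_eq_zero _).2 fun r hr => fr.indep p hp r ?_
    rw [LinearMap.toSpanSingleton_apply, ← Submodule.Quotient.mk_smul,
      Submodule.Quotient.mk_eq_zero] at hr
    exact hr
  · intro z
    obtain ⟨x, rfl⟩ := Submodule.Quotient.mk_surjective _ z
    obtain ⟨r, hr⟩ := fr.gen p hp x x.2
    refine ⟨r, ?_⟩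
    rw [LinearMap.toSpanSingleton_apply, ← Submodule.Quotient.mk_smul, eq_comm,
      Submodule.Quotient.eq]
    exact hr

theorem kodairaSpencer_frame (H : HodgeFiltration D V) (fr : HodgeFrame D H.F) {p : ℕ}
    (hp : p < 3) (r : R) :
    H.kodairaSpencer p (r • Submodule.Quotient.mk ⟨fr.e (p + 1), fr.mem (p + 1) (by omega)⟩) =
      (r * fr.a p) • Submodule.Quotient.mk ⟨fr.e p, fr.mem p (by omega)⟩ := by
  rw [map_smul, mul_smul]
  congr 1
  refine (Submodule.Quotient.eq _).2 ?_
  exact fr.a_spec p hp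

/-- In the trivialisations of E^{p+1} and E^p by the frame the map is multiplication by `fr.a p`, so
its cokernel is R/(a_p). -/
theorem cokerLength_kodairaSpencer (H : HodgeFiltration D V) (fr : HodgeFrame D H.F) {p : ℕ}
    (hp : p < 3) : cokerLength (H.kodairaSpencer p) = Ring.ord R (fr.a p) := by
  obtain ⟨φ, hφ⟩ := H.exists_equiv fr (p := p) (by omega)
  obtain ⟨ψ, hψ⟩ := H.exists_equiv fr (p := p + 1) (by omega)
  refine (LinearEquiv.length_eq (Submodule.Quotient.equiv _ _ φ ?_)).symm
  ext z
  simp only [Submodule.mem_map, Ideal.mem_span_singleton', LinearMap.mem_range]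
  constructor
  · rintro ⟨_, ⟨r, rfl⟩, rfl⟩
    refine ⟨ψ r, ?_⟩
    rw [hψ, H.kodairaSpencer_frame fr hp]
    exact (hφ _).symm
  · rintro ⟨y, rfl⟩
    obtain ⟨r, rfl⟩ := ψ.surjective y
    refine ⟨r * fr.a p, ⟨r, rfl⟩, ?_⟩
    rw [hψ, H.kodairaSpencer_frame fr hp]
    exact hφ _

theorem bijective_kodairaSpencer (H : HodgeFiltration D V) (fr : HodgeFrame D H.F) {p : ℕ}
    (hp : p < 3) (h : IsUnit (fr.a p)) : Function.Bijective (H.kodairaSpencer p) := by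
  obtain ⟨φ, hφ⟩ := H.exists_equiv fr (p := p) (by omega)
  obtain ⟨ψ, hψ⟩ := H.exists_equiv fr (p := p + 1) (by omega)
  have key : ⇑(H.kodairaSpencer p) ∘ ψ = φ ∘ fun r => r * fr.a p := by
    funext r
    simp only [Function.comp_apply]
    rw [hψ, H.kodairaSpencer_frame fr hp, hφ]
  rw [← ψ.bijective.of_comp_iff, key]
  exact φ.bijective.comp (IsUnit.isUnit_iff_mulRight_bijective.1 h)

end HodgeFiltration

/-! ### Connection matrices, indicial polynomial and residue eigenvalues -/

namespace CovDeriv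

variable {R M : Type*} [CommRing R] [AddCommGroup M] [Module R M] (D : CovDeriv R M)

theorem map_zero : D.toFun 0 = 0 := by simpa using D.map_add 0 0

theorem map_sum {ι : Type*} (S : Finset ι) (s : ι → M) :
    D.toFun (∑ i ∈ S, s i) = ∑ i ∈ S, D.toFun (s i) :=
  _root_.map_sum (⟨⟨D.toFun, D.map_zero⟩, D.map_add⟩ : M →+ M) s S

theorem map_sub (s s' : M) : D.toFun (s - s') = D.toFun s - D.toFun s' :=
  _root_.map_sub (⟨⟨D.toFun, D.map_zero⟩, D.map_add⟩ : M →+ M) s s'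

/-- The connection in terms of a family `g` with connection matrix `A`. -/
theorem toFun_combination {g : Fin 4 → M} {A : Matrix (Fin 4) (Fin 4) R}
    (hA : ∀ i, D.toFun (g i) = ∑ j, A j i • g j) (x : Fin 4 → R) :
    D.toFun (∑ i, x i • g i) = ∑ i, (D.d (x i) + A.mulVec x i) • g i := by
  rw [D.map_sum]
  simp only [D.leibniz, hA, add_smul, Finset.sum_add_distrib, Finset.smul_sum, smul_smul,
    Matrix.mulVec, dotProduct, Finset.sum_smul]
  congr 1
  rw [Finset.sum_comm]
  exact Finset.sum_congr rfl fun j _ => Finset.sum_congr rfl fun i _ => by rw [mul_comm]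

/-- The indicial polynomial of a differential equation in terms of the residue of the connection
in a basis of Hessenberg type. -/
theorem indicial_eq (L : LogLocal R D.d) {g : Fin 4 → M} (hg : LinearIndependent R g)
    {x0 x1 x2 x3 h01 h12 h23 h02 h13 h03 : R}
    (hA : ∀ i, D.toFun (g i) = ∑ j, (!![x0, h01, h02, h03; 1, x1, h12, h13; 0, 1, x2, h23;
      0, 0, 1, x3] : Matrix (Fin 4) (Fin 4) R) j i • g j)
    {Q : Fin 4 → R} (hQ : D.Solves Q (g 0)) (y : ℂ) :
    y ^ 4 + ∑ i : Fin 4, L.ev (Q i) * y ^ (i : ℕ) =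
      hessenbergDet (y - L.ev x0) (y - L.ev x1) (y - L.ev x2) (y - L.ev x3) (L.ev h01) (L.ev h12)
        (L.ev h23) (L.ev h02) (L.ev h13) (L.ev h03) := by
  set A := (!![x0, h01, h02, h03; 1, x1, h12, h13; 0, 1, x2, h23; 0, 0, 1, x3] :
    Matrix (Fin 4) (Fin 4) R)
  -- Coordinates of D^k g_0: the recursion is x ↦ d x + A x. Since `d` vanishes at the point, the
  -- values follow the constant recursion by A(0).
  let x : ℕ → Fin 4 → R := fun k =>
    Nat.rec ![1, 0, 0, 0] (fun _ v i => D.d (v i) + A.mulVec v i) k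
  have hx : ∀ k, D.toFun^[k] (g 0) = ∑ i, x k i • g i := by
    intro k
    induction k with
    | zero => simp [x, Fin.sum_univ_four]
    | succ k ih =>
      rw [Function.iterate_succ_apply', ih, D.toFun_combination hA]
  refine hessenbergDet_eq_of_cyclic _ _ _ _ _ _ _ _ _ _ _ (fun k i => L.ev (x k i)) ?_ ?_ ?_ y
  · funext i
    fin_cases i <;> simp [x]
  · intro k
    funext i
    change L.ev (D.d (x k i) + A.mulVec (x k) i) = _
    rw [_root_.map_add, L.ev_d, zero_add]
    fin_cases i <;> simp [A, Matrix.mulVec, dotProduct, Fin.sum_univ_four]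
  · have h := hQ
    unfold Solves at h
    simp only [hx, Finset.smul_sum, smul_smul] at h
    rw [Finset.sum_comm, ← Finset.sum_add_distrib] at h
    simp only [← Finset.sum_smul, ← add_smul] at h
    have h1 := Fintype.linearIndependent_iff.1 hg _ h
    funext i
    simpa using congrArg L.ev (h1 i)

/-- `V` is spanned by Jordan chains of the connection with eigenvalues in `[0,1)`. -/
def JordanSpanned (L : LogLocal R D.d) (V : Submodule R M) : Prop :=
  ∃ S : Set M, V = Submodule.span R S ∧ ∀ s ∈ S, ∃ α : ℝ, 0 ≤ α ∧ α < 1 ∧ ∃ a : R, L.ev a = α ∧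
    ∃ c : ℕ → M, c 0 = s ∧ (∀ j, c j ∈ V) ∧ (∀ j, D.toFun (c j) = a • c j + c (j + 1)) ∧ c 4 = 0

/-- The eigenvalues of the residue on a lattice spanned by Jordan chains. -/
theorem JordanSpanned.eigenvalue {D : CovDeriv R M} {L : LogLocal R D.d} {V : Submodule R M}
    (hV : D.JordanSpanned L V) {g : Fin 4 → M} (hg : LinearIndependent R g)
    (hgV : ∀ i, g i ∈ V) (hspan : ∀ s ∈ V, ∃ x : Fin 4 → R, s = ∑ i, x i • g i)
    {A : Matrix (Fin 4) (Fin 4) R} (hA : ∀ i, D.toFun (g i) = ∑ j, A j i • g j) {z : ℂ}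
    (hz : (A.map L.ev - z • (1 : Matrix (Fin 4) (Fin 4) ℂ)).det = 0) :
    ∃ α : ℝ, 0 ≤ α ∧ α < 1 ∧ z = α := by
  obtain ⟨S, rfl, hS⟩ := hV
  -- A left eigenvector v of A(0). If z were not a real number in [0,1), v would annihilate the
  -- values of all generators of V, hence of the basis g itself.
  obtain ⟨v, hv0, hv⟩ := Matrix.exists_vecMul_eq_zero_iff.2 hz
  by_contra! hcon
  have inj : ∀ x y : Fin 4 → R, ∑ i, x i • g i = ∑ i, y i • g i → x = y := by
    intro x y hxy
    have h : ∑ i, (x i - y i) • g i = 0 := by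
      simp only [sub_smul, Finset.sum_sub_distrib, hxy, sub_self]
    funext i
    exact sub_eq_zero.1 (Fintype.linearIndependent_iff.1 hg _ h i)
  have hv' : ∀ w : Fin 4 → ℂ, v ⬝ᵥ (A.map L.ev).mulVec w = z * (v ⬝ᵥ w) := by
    intro w
    have h1 : (v ᵥ* (A.map L.ev - z • (1 : Matrix (Fin 4) (Fin 4) ℂ))) ⬝ᵥ w = 0 := by
      rw [hv, zero_dotProduct]
    rw [← Matrix.dotProduct_mulVec, Matrix.sub_mulVec, dotProduct_sub, Matrix.smul_mulVec,
      Matrix.one_mulVec, dotProduct_smul, smul_eq_mul] at h1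
    exact sub_eq_zero.1 h1
  have key : ∀ s ∈ Submodule.span R S, ∀ x : Fin 4 → R, s = ∑ i, x i • g i →
      v ⬝ᵥ (fun i => L.ev (x i)) = 0 := by
    intro s hs
    induction hs using Submodule.span_induction with
    | mem s hs =>
      intro x hx
      obtain ⟨α, h0, h1, a, ha, c, rfl, hcV, hc, hc4⟩ := hS s hs
      choose y hy using fun j => hspan (c j) (hcV j)
      -- Along a Jordan chain, pairing values with v gives (z - α)⟨v, c_j⟩ = ⟨v, c_{j+1}⟩; four
      -- steps reach c_4 = 0.
      have hstep : ∀ j, (z - α) * (v ⬝ᵥ fun i => L.ev (y j i)) =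
          v ⬝ᵥ fun i => L.ev (y (j + 1) i) := by
        intro j
        have e1 : (fun i => D.d (y j i) + A.mulVec (y j) i) = fun i => a * y j i + y (j + 1) i := by
          apply inj
          rw [← D.toFun_combination hA, ← hy, hc]
          simp only [add_smul, Finset.sum_add_distrib, ← smul_smul, ← Finset.smul_sum, ← hy]
        have e2 : (A.map L.ev).mulVec (fun i => L.ev (y j i)) =
            (α : ℂ) • (fun i => L.ev (y j i)) + fun i => L.ev (y (j + 1) i) := by
          funext i
          have := congrArg L.ev (congrFun e1 i)
          rw [_root_.map_add, L.ev_d, zero_add, _root_.map_add, _root_.map_mul, ha] at this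
          rw [Pi.add_apply, Pi.smul_apply, smul_eq_mul, ← this, RingHom.map_mulVec]
          rfl
        have e3 := hv' fun i => L.ev (y j i)
        rw [e2, dotProduct_add, dotProduct_smul, smul_eq_mul] at e3
        linear_combination -e3
      have hx0 : x = y 0 := inj _ _ (hx.symm.trans (hy 0))
      have h4 : y 4 = 0 := inj _ _ (by rw [← hy, hc4]; simp)
      have e4 : (z - α) ^ 4 * (v ⬝ᵥ fun i => L.ev (y 0 i)) = 0 := by
        have : v ⬝ᵥ (fun i => L.ev (y 4 i)) = 0 := by
          rw [h4]; simp [dotProduct]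
        rw [← this, ← hstep, ← hstep, ← hstep, ← hstep]
        ring
      rw [hx0]
      exact (mul_eq_zero.1 e4).resolve_left (pow_ne_zero _ (sub_ne_zero.2 (hcon α h0 h1)))
    | zero =>
      intro x hx
      have : x = 0 := inj _ _ (by rw [← hx]; simp)
      simp [this, dotProduct]
    | add s s' hs hs' ih ih' =>
      intro x hx
      obtain ⟨y, hy⟩ := hspan s hs
      obtain ⟨y', hy'⟩ := hspan s' hs'
      have : x = y + y' := inj _ _ (by
        rw [← hx, hy, hy']; simp [add_smul, Finset.sum_add_distrib])
      have e1 := ih y hy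
      have e2 := ih' y' hy'
      simp only [dotProduct, this, Pi.add_apply, _root_.map_add, mul_add,
        Finset.sum_add_distrib] at e1 e2 ⊢
      rw [e1, e2, add_zero]
    | smul r s hs ih =>
      intro x hx
      obtain ⟨y, hy⟩ := hspan s hs
      have : x = r • y := inj _ _ (by
        rw [← hx, hy]; simp [smul_smul, Finset.smul_sum])
      have e1 := ih y hy
      simp only [dotProduct, this, Pi.smul_apply, smul_eq_mul, _root_.map_mul] at e1 ⊢
      simp only [mul_left_comm _ (L.ev r), ← Finset.mul_sum, e1, mul_zero]
  refine hv0 (funext fun i => ?_)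
  have := key (g i) (hgV i) (Pi.single i 1) (by simp [Pi.single_apply])
  simpa [dotProduct, Pi.single_apply, apply_ite L.ev] using this

end CovDeriv

/-! ### Coordinates in a Hodge frame and the cyclic section -/

namespace HodgeFrame

variable {R M : Type*} [CommRing R] [AddCommGroup M] [Module R M]
  {D : CovDeriv R M} {F : ℕ → Submodule R M} (fr : HodgeFrame D F)

theorem exists_step (p : ℕ) (hp : p < 4) {x : M} (hx : x ∈ F p) :
    ∃ r : R, ∃ y ∈ F (p + 1), x = r • fr.e p + y := by
  obtain ⟨r, hr⟩ := fr.gen p hp x hx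
  exact ⟨r, _, hr, by abel⟩

theorem exists_step_deriv (p : ℕ) (hp : p < 3) :
    ∃ y ∈ F (p + 1), D.toFun (fr.e (p + 1)) = fr.a p • fr.e p + y :=
  ⟨_, fr.a_spec p hp, by abel⟩

theorem coords_three (h4 : F 4 = ⊥) {x : M} (hx : x ∈ F 3) : ∃ r : R, x = r • fr.e 3 := by
  obtain ⟨r, y, hy, rfl⟩ := fr.exists_step 3 (by omega) hx
  rw [h4, Submodule.mem_bot] at hy
  exact ⟨r, by rw [hy, add_zero]⟩

theorem coords_two (h4 : F 4 = ⊥) {x : M} (hx : x ∈ F 2) :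
    ∃ r r' : R, x = r • fr.e 3 + r' • fr.e 2 := by
  obtain ⟨r, y, hy, rfl⟩ := fr.exists_step 2 (by omega) hx
  obtain ⟨s, rfl⟩ := fr.coords_three h4 hy
  exact ⟨s, r, by abel⟩

theorem coords_one (h4 : F 4 = ⊥) {x : M} (hx : x ∈ F 1) :
    ∃ r r' r'' : R, x = r • fr.e 3 + r' • fr.e 2 + r'' • fr.e 1 := by
  obtain ⟨r, y, hy, rfl⟩ := fr.exists_step 1 (by omega) hx
  obtain ⟨s, s', rfl⟩ := fr.coords_two h4 hy
  exact ⟨s, s', r, by abel⟩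

theorem coords_zero (h4 : F 4 = ⊥) {x : M} (hx : x ∈ F 0) :
    ∃ r r' r'' r''' : R, x = r • fr.e 3 + r' • fr.e 2 + r'' • fr.e 1 + r''' • fr.e 0 := by
  obtain ⟨r, y, hy, rfl⟩ := fr.exists_step 0 (by omega) hx
  obtain ⟨s, s', s'', rfl⟩ := fr.coords_one h4 hy
  exact ⟨s, s', s'', r, by abel⟩

theorem coords_eq_zero (anti : ∀ p, F (p + 1) ≤ F p) {r0 r1 r2 r3 : R}
    (h : r0 • fr.e 3 + r1 • fr.e 2 + r2 • fr.e 1 + r3 • fr.e 0 = 0) :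
    r0 = 0 ∧ r1 = 0 ∧ r2 = 0 ∧ r3 = 0 := by
  have m3 := fr.mem 3 (by omega)
  have m2 := fr.mem 2 (by omega)
  have m1 := fr.mem 1 (by omega)
  have h3 : r3 = 0 := fr.indep 0 (by omega) _ (by
    rw [← neg_eq_iff_add_eq_zero.2 h]
    exact neg_mem (add_mem (add_mem (Submodule.smul_mem _ _ (anti _ (anti _ m3)))
      (Submodule.smul_mem _ _ (anti _ m2))) (Submodule.smul_mem _ _ m1)))
  subst h3
  rw [zero_smul, add_zero] at h
  have h2 : r2 = 0 := fr.indep 1 (by omega) _ (by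
    rw [← neg_eq_iff_add_eq_zero.2 h]
    exact neg_mem (add_mem (Submodule.smul_mem _ _ (anti _ m3)) (Submodule.smul_mem _ _ m2)))
  subst h2
  rw [zero_smul, add_zero] at h
  have h1 : r1 = 0 := fr.indep 2 (by omega) _ (by
    rw [← neg_eq_iff_add_eq_zero.2 h]
    exact neg_mem (Submodule.smul_mem _ _ m3))
  subst h1
  rw [zero_smul, add_zero] at h
  exact ⟨fr.indep 3 (by omega) _ (by rw [h]; exact zero_mem _), rfl, rfl, rfl⟩

theorem linearIndependent_smul [IsDomain R] (anti : ∀ p, F (p + 1) ≤ F p)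
    {c0 c1 c2 c3 : R} (h0 : c0 ≠ 0) (h1 : c1 ≠ 0) (h2 : c2 ≠ 0) (h3 : c3 ≠ 0) :
    LinearIndependent R ![c0 • fr.e 3, c1 • fr.e 2, c2 • fr.e 1, c3 • fr.e 0] := by
  refine Fintype.linearIndependent_iff.2 fun x hx => ?_
  simp only [Fin.sum_univ_four, Matrix.cons_val, smul_smul] at hx
  obtain ⟨e0, e1, e2, e3⟩ := fr.coords_eq_zero anti hx
  intro i
  fin_cases i
  · exact (mul_eq_zero.1 e0).resolve_right h0
  · exact (mul_eq_zero.1 e1).resolve_right h1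
  · exact (mul_eq_zero.1 e2).resolve_right h2
  · exact (mul_eq_zero.1 e3).resolve_right h3

/-- Griffiths transversality keeps the derivative of the error in F^{p+1}, and so lies the Leibniz
term d(c) e_{p+1}. Each derivation thus multiplies the leading coefficient by one Kodaira–Spencer
entry. -/
theorem deriv_leading (griffiths : ∀ p, ∀ s ∈ F (p + 1), D.toFun s ∈ F p)
    {p : ℕ} (hp : p < 3) {s : M} {c : R} (hs : s - c • fr.e (p + 1) ∈ F (p + 2)) :
    D.toFun s - (c * fr.a p) • fr.e p ∈ F (p + 1) := by
  have h1 := griffiths _ _ hs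
  have h2 := fr.a_spec p hp
  rw [D.map_sub, D.leibniz] at h1
  have h3 := add_mem (add_mem h1 (Submodule.smul_mem _ c h2))
    (Submodule.smul_mem _ (D.d c) (fr.mem (p + 1) (by omega)))
  convert h3 using 1
  rw [smul_sub, mul_smul]
  abel

/-- The leading terms of `ω, Dω, D²ω, D³ω`. -/
theorem iterate_leading (griffiths : ∀ p, ∀ s ∈ F (p + 1), D.toFun s ∈ F p) (f : R) :
    D.toFun^[1] (f • fr.e 3) - (f * fr.a 2) • fr.e 2 ∈ F 3 ∧
    D.toFun^[2] (f • fr.e 3) - (f * fr.a 2 * fr.a 1) • fr.e 1 ∈ F 2 ∧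
    D.toFun^[3] (f • fr.e 3) - (f * fr.a 2 * fr.a 1 * fr.a 0) • fr.e 0 ∈ F 1 := by
  have h1 : D.toFun^[1] (f • fr.e 3) - (f * fr.a 2) • fr.e 2 ∈ F 3 :=
    fr.deriv_leading griffiths (by omega) (by simp)
  have h2 : D.toFun^[2] (f • fr.e 3) - (f * fr.a 2 * fr.a 1) • fr.e 1 ∈ F 2 := by
    rw [Function.iterate_succ_apply']
    exact fr.deriv_leading griffiths (by omega) h1
  refine ⟨h1, h2, ?_⟩
  rw [Function.iterate_succ_apply']
  exact fr.deriv_leading griffiths (by omega) h2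

/-- The product is the leading coefficient of D³ω. If it vanished, ω, …, D³ω would be four
independent elements of F¹, which three elements generate. -/
theorem ne_zero_of_cyclic [IsDomain R] (h4 : F 4 = ⊥) (anti : ∀ p, F (p + 1) ≤ F p)
    (griffiths : ∀ p, ∀ s ∈ F (p + 1), D.toFun s ∈ F p) {f : R} (h : D.Cyclic (f • fr.e 3)) :
    f * fr.a 2 * fr.a 1 * fr.a 0 ≠ 0 := by
  intro h0
  obtain ⟨i1, i2, i3⟩ := fr.iterate_leading griffiths f
  rw [h0, zero_smul, sub_zero] at i3
  have m3 : f • fr.e 3 ∈ F 3 := Submodule.smul_mem _ _ (fr.mem 3 (by omega))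
  have hmem : ∀ i : Fin 4, D.toFun^[(i : ℕ)] (f • fr.e 3) ∈ F 1 := by
    intro i
    fin_cases i
    · exact anti _ (anti _ m3)
    · exact anti _ (griffiths _ _ m3)
    · exact griffiths _ _ (griffiths _ _ m3)
    · exact i3
  classical
  have := linearIndependent_le_span' _ h (({fr.e 3, fr.e 2, fr.e 1} : Finset M) : Set M) (by
    rintro _ ⟨i, rfl⟩
    obtain ⟨r, r', r'', hr⟩ := fr.coords_one h4 (hmem i)
    dsimp only at hr ⊢
    rw [hr]
    refine add_mem (add_mem ?_ ?_) ?_ <;>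
      exact Submodule.smul_mem _ _ (Submodule.subset_span (by simp)))
  have h3 : (Fintype.card (({fr.e 3, fr.e 2, fr.e 1} : Finset M) : Set M)) ≤ 3 := by
    simpa using Finset.card_le_three
  rw [Cardinal.mk_fin] at this
  have h5 : 4 ≤ Fintype.card (({fr.e 3, fr.e 2, fr.e 1} : Finset M) : Set M) := by
    exact_mod_cast this
  omega

end HodgeFrame

namespace HodgeFrame

variable {R M : Type*} [CommRing R] [AddCommGroup M] [Module R M]
  {D : CovDeriv R M} {F : ℕ → Submodule R M} (fr : HodgeFrame D F)

/-- The orders of vanishing of the Kodaira–Spencer maps of a logarithmic connection are the gaps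
between the integral parts of the roots of the indicial polynomial. -/
theorem exists_indicial_roots (L : LogLocal R D.d) (h4 : F 4 = ⊥) (anti : ∀ p, F (p + 1) ≤ F p)
    (griffiths : ∀ p, ∀ s ∈ F (p + 1), D.toFun s ∈ F p) (hV : ∀ s ∈ F 0, D.toFun s ∈ F 0)
    (hJ : D.JordanSpanned L (F 0)) {f : R} (hc : D.Cyclic (f • fr.e 3)) {Q : Fin 4 → R}
    (hQ : D.Solves Q (f • fr.e 3)) :
    ∃ m n0 n1 n2 : ℕ, Ring.ord R (fr.a 2) = n0 ∧ Ring.ord R (fr.a 1) = n1 ∧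
      Ring.ord R (fr.a 0) = n2 ∧ ∃ r : Fin 4 → ℝ, (∀ i, 0 ≤ r i) ∧ (∀ i, r i < 1) ∧
        ∀ y : ℂ, y ^ 4 + ∑ i : Fin 4, L.ev (Q i) * y ^ (i : ℕ) =
          (y - (m + r 0)) * (y - (m + n0 + r 1)) * (y - (m + n0 + n1 + r 2)) *
            (y - (m + n0 + n1 + n2 + r 3)) := by
  have := L.isDomain
  have hne := fr.ne_zero_of_cyclic h4 anti griffiths hc
  have hne' : ((f ≠ 0 ∧ fr.a 2 ≠ 0) ∧ fr.a 1 ≠ 0) ∧ fr.a 0 ≠ 0 := by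
    simpa only [mul_ne_zero_iff] using hne
  obtain ⟨⟨⟨hf, ha2⟩, ha1⟩, ha0⟩ := hne'
  obtain ⟨m, u, hu, hfu⟩ := L.factor _ hf
  obtain ⟨n0, u0, hu0, hau0⟩ := L.factor _ ha2
  obtain ⟨n1, u1, hu1, hau1⟩ := L.factor _ ha1
  obtain ⟨n2, u2, hu2, hau2⟩ := L.factor _ ha0
  -- Logarithmic derivatives of the four scaling functions; their values are the future diagonal
  -- shifts.
  obtain ⟨l0, hl0, el0⟩ := L.exists_logDeriv m hu
  obtain ⟨l1, hl1, el1⟩ := L.exists_logDeriv (m + n0) (hu.mul hu0)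
  obtain ⟨l2, hl2, el2⟩ := L.exists_logDeriv (m + n0 + n1) ((hu.mul hu0).mul hu1)
  obtain ⟨l3, hl3, el3⟩ := L.exists_logDeriv (m + n0 + n1 + n2) (((hu.mul hu0).mul hu1).mul hu2)
  have p0 : L.t ^ m * u = f := hfu.symm
  have p1 : L.t ^ (m + n0) * (u * u0) = f * fr.a 2 := by rw [hfu, hau0]; ring
  have p2 : L.t ^ (m + n0 + n1) * (u * u0 * u1) = f * fr.a 2 * fr.a 1 := by
    rw [hfu, hau0, hau1]; ring
  have p3 : L.t ^ (m + n0 + n1 + n2) * (u * u0 * u1 * u2) = f * fr.a 2 * fr.a 1 * fr.a 0 := by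
    rw [hfu, hau0, hau1, hau2]; ring
  rw [p0] at hl0
  rw [p1] at hl1
  rw [p2] at hl2
  rw [p3] at hl3
  obtain ⟨y3, hy3, d3⟩ := fr.exists_step_deriv 2 (by omega)
  obtain ⟨y2, hy2, d2⟩ := fr.exists_step_deriv 1 (by omega)
  obtain ⟨y1, hy1, d1⟩ := fr.exists_step_deriv 0 (by omega)
  obtain ⟨x0, rfl⟩ := fr.coords_three h4 hy3
  obtain ⟨u01, x1, rfl⟩ := fr.coords_two h4 hy2
  obtain ⟨u02, u12, x2, rfl⟩ := fr.coords_one h4 hy1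
  obtain ⟨u03, u13, u23, x3, d0⟩ := fr.coords_zero h4 (hV _ (fr.mem 0 (by omega)))
  simp only [zero_add, one_add_one_eq_two, Nat.reduceAdd] at d0 d1 d2 d3
  have hlin1 := fr.linearIndependent_smul anti one_ne_zero one_ne_zero one_ne_zero one_ne_zero
  simp only [one_smul] at hlin1
  have hlinc := fr.linearIndependent_smul anti hf (mul_ne_zero hf ha2)
    (mul_ne_zero (mul_ne_zero hf ha2) ha1) hne
  have hA : ∀ i, D.toFun (![fr.e 3, fr.e 2, fr.e 1, fr.e 0] i) =
      ∑ j, (!![x0, u01, u02, u03; fr.a 2, x1, u12, u13; 0, fr.a 1, x2, u23; 0, 0, fr.a 0, x3] :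
        Matrix (Fin 4) (Fin 4) R) j i • ![fr.e 3, fr.e 2, fr.e 1, fr.e 0] j := by
    intro i
    fin_cases i
    · simp [Fin.sum_univ_four, d3]; abel
    · simp [Fin.sum_univ_four, d2]; abel
    · simp [Fin.sum_univ_four, d1]; abel
    · simp [Fin.sum_univ_four, d0]
  -- In the rescaled frame the subdiagonal becomes 1, and each entry above the diagonal acquires the
  -- product of the a_p it crosses.
  have hA' : ∀ i, D.toFun (![f • fr.e 3, (f * fr.a 2) • fr.e 2, (f * fr.a 2 * fr.a 1) • fr.e 1,
        (f * fr.a 2 * fr.a 1 * fr.a 0) • fr.e 0] i) =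
      ∑ j, (!![l0 + x0, fr.a 2 * u01, fr.a 2 * fr.a 1 * u02, fr.a 2 * fr.a 1 * fr.a 0 * u03;
        1, l1 + x1, fr.a 1 * u12, fr.a 1 * fr.a 0 * u13; 0, 1, l2 + x2, fr.a 0 * u23;
        0, 0, 1, l3 + x3] : Matrix (Fin 4) (Fin 4) R) j i •
        ![f • fr.e 3, (f * fr.a 2) • fr.e 2, (f * fr.a 2 * fr.a 1) • fr.e 1,
        (f * fr.a 2 * fr.a 1 * fr.a 0) • fr.e 0] j := by
    intro i
    fin_cases i
    · simp [Fin.sum_univ_four, D.leibniz, d3, hl0]; module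
    · simp [Fin.sum_univ_four, D.leibniz, d2, hl1]; module
    · simp [Fin.sum_univ_four, D.leibniz, d1, hl2]; module
    · simp [Fin.sum_univ_four, D.leibniz, d0, hl3]; module
  have zero_or : ∀ (n : ℕ) {a v : R}, a = L.t ^ n * v → n = 0 ∨ L.ev a = 0 := by
    intro n a v h
    rcases Nat.eq_zero_or_pos n with h0 | h0
    · exact Or.inl h0
    · refine Or.inr ?_
      rw [h, map_mul, map_pow, L.ev_t, zero_pow h0.ne', zero_mul]
  obtain ⟨r, hr, hr'⟩ := exists_roots_hessenbergDet (L.ev x0) (L.ev x1) (L.ev x2) (L.ev x3)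
    (L.ev (fr.a 2)) (L.ev (fr.a 1)) (L.ev (fr.a 0)) (L.ev u01) (L.ev u12) (L.ev u23) (L.ev u02)
    (L.ev u13) (L.ev u03) m n0 n1 n2 (zero_or n0 hau0) (zero_or n1 hau1) (zero_or n2 hau2)
  -- The unshifted roots r_i are eigenvalues of the residue on V itself, so they lie in [0,1).
  have hroot : ∀ i, ∃ α : ℝ, 0 ≤ α ∧ α < 1 ∧ r i = α := by
    intro i
    refine hJ.eigenvalue hlin1 ?_ ?_ hA ?_
    · intro j
      fin_cases j
      · exact anti _ (anti _ (anti _ (fr.mem 3 (by omega))))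
      · exact anti _ (anti _ (fr.mem 2 (by omega)))
      · exact anti _ (fr.mem 1 (by omega))
      · exact fr.mem 0 (by omega)
    · intro s hs
      obtain ⟨c0, c1, c2, c3, h⟩ := fr.coords_zero h4 hs
      exact ⟨![c0, c1, c2, c3], by simp [Fin.sum_univ_four, h]⟩
    · have e1 := det_hessenberg (r i) (L.ev x0) (L.ev x1) (L.ev x2) (L.ev x3)
        (L.ev (fr.a 2)) (L.ev (fr.a 1)) (L.ev (fr.a 0)) (L.ev u01) (L.ev u12) (L.ev u23)
        (L.ev u02) (L.ev u13) (L.ev u03)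
      rw [hr, Finset.prod_eq_zero (Finset.mem_univ i) (sub_self _)] at e1
      rw [← e1]
      congr 2
      ext j k
      fin_cases j <;> fin_cases k <;> simp
  choose ρ hρ0 hρ1 hρ using hroot
  refine ⟨m, n0, n1, n2, by rw [hau0, L.ord_eq _ hu0], by rw [hau1, L.ord_eq _ hu1],
    by rw [hau2, L.ord_eq _ hu2], ρ, hρ0, hρ1, fun y => ?_⟩
  have hi := D.indicial_eq L hlinc hA' hQ y
  rw [hi]
  simp only [map_add, map_mul, el0, el1, el2, el3, ← hρ]
  rw [← hr' y]
  push_cast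
  rfl

end HodgeFrame

/-! ### Self-duality and the Yukawa coupling -/

/-- A flat bilinear pairing on a module with connection, with values in a differential ring. -/
structure FlatPairing {R M K : Type*} [CommRing R] [AddCommGroup M] [Module R M] [CommRing K]
    (D : CovDeriv R M) (φ : R →+* K) (dK : K → K) (B : M → M → K) : Prop where
  add_left : ∀ s s' r, B (s + s') r = B s r + B s' r
  add_right : ∀ r s s', B r (s + s') = B r s + B r s'
  smul_left : ∀ a s s', B (a • s) s' = φ a * B s s'
  smul_right : ∀ a s s', B s (a • s') = φ a * B s s'
  leibniz : ∀ s s', dK (B s s') = B (D.toFun s) s' + B s (D.toFun s')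
  dK_add : ∀ x y, dK (x + y) = dK x + dK y
  dK_mul : ∀ a x, dK (φ a * x) = φ (D.d a) * x + φ a * dK x
  two_cancel : ∀ x : K, 2 * x = 0 → x = 0

/-- At the point all derivatives drop out. Were the remaining number nonzero, the factor of Y would
be a unit and Y would vanish. -/
theorem LogLocal.indicial_symmetric {R K : Type*} [CommRing R] [CommRing K] {d : R → R}
    (L : LogLocal R d) (φ : R →+* K) {Q : Fin 4 → R} {Y : K} (hY : Y ≠ 0)
    (h : φ (8 * Q 1 + 2 * d (2 * d (Q 3) + Q 3 ^ 2 - 4 * Q 2) +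
      (2 * d (Q 3) + Q 3 ^ 2 - 4 * Q 2) * Q 3) * Y = 0) :
    8 * L.ev (Q 1) + (L.ev (Q 3) ^ 2 - 4 * L.ev (Q 2)) * L.ev (Q 3) = 0 := by
  by_contra hne
  refine hY (((L.isUnit_of_ev _ fun h0 => hne ?_).map φ).mul_right_eq_zero.1 h)
  simpa [L.ev_d, map_ofNat L.ev] using h0

namespace FlatPairing

variable {R M K : Type*} [CommRing R] [AddCommGroup M] [Module R M] [CommRing K]
    {D : CovDeriv R M} {φ : R →+* K} {dK : K → K} {B : M → M → K} (P : FlatPairing D φ dK B)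

include P

theorem dK_zero : dK 0 = 0 := by simpa using P.dK_add 0 0

theorem dK_neg (x : K) : dK (-x) = -dK x := by
  have h := P.dK_add x (-x)
  rw [add_neg_cancel, P.dK_zero] at h
  linear_combination -h

theorem dK_natCast_mul (n : ℕ) (x : K) : dK (n * x) = n * dK x := by
  induction n with
  | zero => simp [P.dK_zero]
  | succ n ih => push_cast; rw [add_mul, add_mul, P.dK_add, ih, one_mul, one_mul]

/-- The relations imposed by a self-duality on a differential equation of order four and on its
Yukawa coupling `Y = B(ω, D³ω)`. -/
theorem yukawa {F : ℕ → Submodule R M} (anti : ∀ p, F (p + 1) ≤ F p)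
    (griffiths : ∀ p, ∀ s ∈ F (p + 1), D.toFun s ∈ F p)
    (orth : ∀ p ≤ 4, ∀ s ∈ F p, ∀ s' ∈ F (4 - p), B s s' = 0)
    {ω : M} (hω : ω ∈ F 3) {Q : Fin 4 → R} (hQ : D.Solves Q ω) :
    B (D.toFun^[3] ω) ω = -B ω (D.toFun^[3] ω) ∧
    2 * dK (B ω (D.toFun^[3] ω)) = -(φ (Q 3) * B ω (D.toFun^[3] ω)) ∧
    φ (8 * Q 1 + 2 * D.d (2 * D.d (Q 3) + Q 3 ^ 2 - 4 * Q 2) +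
      (2 * D.d (Q 3) + Q 3 ^ 2 - 4 * Q 2) * Q 3) * B ω (D.toFun^[3] ω) = 0 := by
  set m : ℕ → ℕ → K := fun i j => B (D.toFun^[i] ω) (D.toFun^[j] ω) with hm
  have w1 : D.toFun^[1] ω ∈ F 2 := griffiths _ _ hω
  have w2 : D.toFun^[2] ω ∈ F 1 := by
    rw [Function.iterate_succ_apply']
    exact griffiths _ _ w1
  have m00 : m 0 0 = 0 := orth 3 (by omega) _ hω _ (anti _ (anti _ hω))
  have m01 : m 0 1 = 0 := orth 3 (by omega) _ hω _ (anti _ w1)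
  have m02 : m 0 2 = 0 := orth 3 (by omega) _ hω _ w2
  have m11 : m 1 1 = 0 := orth 2 (by omega) _ w1 _ w1
  have m10 : m 1 0 = 0 := orth 1 (by omega) _ (anti _ w1) _ hω
  have m20 : m 2 0 = 0 := orth 1 (by omega) _ w2 _ hω
  have step : ∀ i j, dK (m i j) = m (i + 1) j + m i (j + 1) := by
    intro i j
    simp only [hm, Function.iterate_succ_apply']
    exact P.leibniz _ _
  have sol : D.toFun^[4] ω = (-Q 0) • D.toFun^[0] ω + (-Q 1) • D.toFun^[1] ω +
      (-Q 2) • D.toFun^[2] ω + (-Q 3) • D.toFun^[3] ω := by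
    have h := eq_neg_of_add_eq_zero_left hQ
    rw [h, Fin.sum_univ_four]
    simp only [Fin.val_zero, Fin.val_one, Fin.val_two]
    change -(_ + _ + _ + Q 3 • D.toFun^[3] ω) = _
    module
  have r4 : ∀ i, m i 4 = -(φ (Q 0) * m i 0 + φ (Q 1) * m i 1 + φ (Q 2) * m i 2 +
      φ (Q 3) * m i 3) := by
    intro i
    change B _ (D.toFun^[4] ω) = _
    rw [sol, P.add_right, P.add_right, P.add_right, P.smul_right, P.smul_right, P.smul_right,
      P.smul_right]
    simp only [map_neg, hm]
    ring
  have l4 : ∀ i, m 4 i = -(φ (Q 0) * m 0 i + φ (Q 1) * m 1 i + φ (Q 2) * m 2 i +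
      φ (Q 3) * m 3 i) := by
    intro i
    change B (D.toFun^[4] ω) _ = _
    rw [sol, P.add_left, P.add_left, P.add_left, P.smul_left, P.smul_left, P.smul_left,
      P.smul_left]
    simp only [map_neg, hm]
    ring
  have s02 := step 0 2
  have s11 := step 1 1
  have s20 := step 2 0
  have s03 := step 0 3
  have s12 := step 1 2
  have s21 := step 2 1
  have s30 := step 3 0
  have s13 := step 1 3
  have s22 := step 2 2
  have s31 := step 3 1
  have s23 := step 2 3
  have s32 := step 3 2
  simp only [zero_add, Nat.reduceAdd] at s02 s11 s20 s03 s12 s21 s30 s13 s22 s31 s23 s32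
  rw [m02, P.dK_zero] at s02
  rw [m11, P.dK_zero] at s11
  rw [m20, P.dK_zero] at s20
  -- Differentiating the vanishing pairings of total order two expresses all those of order three by
  -- Y = m 0 3.
  have e12 : m 1 2 = -m 0 3 := by linear_combination -s02
  have e21 : m 2 1 = m 0 3 := by linear_combination -s11 - e12
  have e30 : m 3 0 = -m 0 3 := by linear_combination -s20 - e21
  rw [e12, P.dK_neg] at s12
  rw [e21] at s21
  rw [e30, P.dK_neg] at s30
  rw [r4, m00, m01, m02] at s03
  rw [l4, m00, m10, m20, e30] at s30
  have d1 : 2 * dK (m 0 3) = -(φ (Q 3) * m 0 3) := by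
    refine sub_eq_zero.1 (P.two_cancel _ ?_)
    linear_combination s21 - s12 + s03 - s30
  have e22 : m 2 2 = 0 := by linear_combination -s12 + s03 - d1
  have e13 : 2 * m 1 3 = φ (Q 3) * m 0 3 := by linear_combination d1 - 2 * s03
  have e31 : m 3 1 = -m 1 3 := by linear_combination -s30 - s03
  rw [e22, P.dK_zero] at s22
  rw [r4, m10, m11, e12] at s13
  have k23 : 4 * m 2 3 = φ (2 * D.d (Q 3) + Q 3 ^ 2 - 4 * Q 2) * m 0 3 := by
    have h := congrArg dK e13
    have h2 := P.dK_natCast_mul 2 (m 1 3)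
    push_cast at h2
    rw [h2, P.dK_mul] at h
    simp only [map_sub, map_add, map_mul, map_pow, map_ofNat]
    linear_combination 2 * h - 4 * s13 + φ (Q 3) * d1 + 2 * φ (Q 3) * e13
  rw [r4, m20, e21, e22] at s23
  rw [show m 3 2 = -m 2 3 by linear_combination -s22, P.dK_neg, l4, m02, e12, e22,
    show m 3 2 = -m 2 3 by linear_combination -s22] at s32
  -- Subtracting the derivatives of m 2 3 and m 3 2 = -m 2 3 eliminates the unknown m 3 3. Only
  -- cancellation of 2 is available in K.
  have e33 : dK (m 2 3) = -(φ (Q 1) * m 0 3) - φ (Q 3) * m 2 3 := by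
    refine sub_eq_zero.1 (P.two_cancel _ ?_)
    linear_combination s23 - s32
  refine ⟨e30, d1, ?_⟩
  change _ * m 0 3 = 0
  -- Differentiating `k23` and eliminating m 2 3 and the derivative of Y leaves a multiple of Y
  -- alone.
  have h := congrArg dK k23
  have h4 := P.dK_natCast_mul 4 (m 2 3)
  push_cast at h4
  rw [h4, P.dK_mul, e33] at h
  rw [map_add φ (8 * Q 1 + _), map_add φ (8 * Q 1), map_mul φ _ (Q 3), map_mul φ 2, map_mul φ 8,
    map_ofNat, map_ofNat]
  linear_combination (-2) * h - φ (2 * D.d (Q 3) + Q 3 ^ 2 - 4 * Q 2) * d1 + 2 * φ (Q 3) * k23 * (-1)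

/-- If the Yukawa coupling vanishes, the cyclic section is orthogonal to the whole lattice. -/
theorem orthogonal_of_yukawa_eq_zero (L : LogLocal R D.d) {F : ℕ → Submodule R M}
    (fr : HodgeFrame D F) (h4 : F 4 = ⊥) (anti : ∀ p, F (p + 1) ≤ F p)
    (griffiths : ∀ p, ∀ s ∈ F (p + 1), D.toFun s ∈ F p)
    (orth : ∀ p ≤ 4, ∀ s ∈ F p, ∀ s' ∈ F (4 - p), B s s' = 0)
    (ht : ∀ x : K, φ L.t * x = 0 → x = 0) {f : R} (hc : D.Cyclic (f • fr.e 3))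
    (h : B (D.toFun^[3] (f • fr.e 3)) (f • fr.e 3) = 0) :
    ∀ s ∈ F 0, B s (f • fr.e 3) = 0 := by
  have := L.isDomain
  have hne := fr.ne_zero_of_cyclic h4 anti griffiths hc
  have hω : f • fr.e 3 ∈ F 3 := Submodule.smul_mem _ _ (fr.mem 3 (by omega))
  obtain ⟨-, -, h3⟩ := fr.iterate_leading griffiths f
  set c := f * fr.a 2 * fr.a 1 * fr.a 0
  have hpow : ∀ (n : ℕ) (x : K), φ L.t ^ n * x = 0 → x = 0 := by
    intro n
    induction n with
    | zero => intro x hx; simpa using hx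
    | succ n ih => intro x hx; exact ht x (ih _ (by rw [← hx]; ring))
  have hφ : ∀ x : K, φ c * x = 0 → x = 0 := by
    obtain ⟨n, u, hu, hcu⟩ := L.factor c hne
    intro x hx
    rw [hcu, map_mul, map_pow, mul_comm _ (φ u), mul_assoc, (hu.map φ).mul_right_eq_zero] at hx
    exact hpow n x hx
  -- D³ω equals c e_0 modulo F¹, and F¹ is orthogonal to ω; multiplication by the nonzero c is
  -- injective on K.
  have h0 : B (fr.e 0) (f • fr.e 3) = 0 := by
    refine hφ _ ?_
    rw [← P.smul_left]
    have e1 := orth 1 (by omega) _ h3 _ hω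
    rw [← sub_add_cancel (D.toFun^[3] (f • fr.e 3)) (c • fr.e 0), P.add_left, e1, zero_add] at h
    exact h
  intro s hs
  obtain ⟨r, y, hy, rfl⟩ := fr.exists_step 0 (by omega) hs
  rw [P.add_left, P.smul_left, h0, mul_zero, zero_add]
  exact orth 1 (by omega) _ hy _ hω

end FlatPairing

/-! ### Germs of analytic functions -/

/-- A ring with operator `d` identified with the germs at `0` of analytic functions with the
operator `z d/dz`. -/
structure AnalyticModel (R : Type*) [CommRing R] (d : R → R) where
  of : ∀ g : ℂ → ℂ, AnalyticAt ℂ g 0 → R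
  surj : ∀ a, ∃ g, ∃ hg : AnalyticAt ℂ g 0, a = of g hg
  eq_iff : ∀ {f g} (hf : AnalyticAt ℂ f 0) (hg : AnalyticAt ℂ g 0),
    of f hf = of g hg ↔ f =ᶠ[𝓝 0] g
  of_zero : of (fun _ => 0) analyticAt_const = 0
  of_one : of (fun _ => 1) analyticAt_const = 1
  of_add : ∀ {f g} (hf : AnalyticAt ℂ f 0) (hg : AnalyticAt ℂ g 0),
    of f hf + of g hg = of (f + g) (hf.add hg)
  of_mul : ∀ {f g} (hf : AnalyticAt ℂ f 0) (hg : AnalyticAt ℂ g 0),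
    of f hf * of g hg = of (f * g) (hf.mul hg)
  d_of : ∀ {g} (hg : AnalyticAt ℂ g 0), d (of g hg) = of (fun z => z * deriv g z)
    (analyticAt_id.mul hg.deriv)

namespace AnalyticModel

variable {R : Type*} [CommRing R] {d : R → R} (A : AnalyticModel R d)

/-- The analytic function representing an element. -/
def rep (a : R) : ℂ → ℂ := (A.surj a).choose

theorem rep_analyticAt (a : R) : AnalyticAt ℂ (A.rep a) 0 := (A.surj a).choose_spec.choose

theorem of_rep (a : R) : A.of (A.rep a) (A.rep_analyticAt a) = a :=
  (A.surj a).choose_spec.choose_spec.symm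

theorem rep_of {g : ℂ → ℂ} (hg : AnalyticAt ℂ g 0) : A.rep (A.of g hg) =ᶠ[𝓝 0] g :=
  (A.eq_iff _ hg).1 (A.of_rep _)

/-- The value at the point. -/
def ev : R →+* ℂ where
  toFun a := A.rep a 0
  map_one' := by rw [← A.of_one, (A.rep_of _).eq_of_nhds]
  map_zero' := by rw [← A.of_zero, (A.rep_of _).eq_of_nhds]
  map_add' a b := by
    conv_lhs => rw [← A.of_rep a, ← A.of_rep b, A.of_add, (A.rep_of _).eq_of_nhds]
    rfl
  map_mul' a b := by
    conv_lhs => rw [← A.of_rep a, ← A.of_rep b, A.of_mul, (A.rep_of _).eq_of_nhds]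
    rfl

theorem ev_of {g : ℂ → ℂ} (hg : AnalyticAt ℂ g 0) : A.ev (A.of g hg) = g 0 :=
  (A.rep_of hg).eq_of_nhds

theorem of_pow {g : ℂ → ℂ} (hg : AnalyticAt ℂ g 0) (n : ℕ) :
    A.of g hg ^ n = A.of (g ^ n) (hg.pow n) := by
  induction n with
  | zero =>
    rw [pow_zero, ← A.of_one, A.eq_iff]
    exact Eventually.of_forall fun z => by simp
  | succ n ih =>
    rw [pow_succ, ih, A.of_mul, A.eq_iff]
    exact Eventually.of_forall fun z => by simp [pow_succ]

theorem isUnit_of_ne_zero {g : ℂ → ℂ} (hg : AnalyticAt ℂ g 0) (h : g 0 ≠ 0) :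
    IsUnit (A.of g hg) := by
  refine IsUnit.of_mul_eq_one (A.of g⁻¹ (hg.inv h)) ?_
  rw [A.of_mul, ← A.of_one, A.eq_iff]
  filter_upwards [hg.continuousAt.eventually_ne h] with z hz
  simp [hz]

/-- Analytic germs form a local ring with logarithmic derivation. -/
def logLocal : LogLocal R d where
  ev := A.ev
  t := A.of (fun z => z) analyticAt_id
  d_mul a b := by
    obtain ⟨f, hf, rfl⟩ := A.surj a
    obtain ⟨g, hg, rfl⟩ := A.surj b
    simp only [A.of_mul, A.d_of, A.of_add, A.eq_iff]
    filter_upwards [hf.eventually_analyticAt, hg.eventually_analyticAt] with z h1 h2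
    simp only [Pi.add_apply, Pi.mul_apply]
    rw [deriv_mul h1.differentiableAt h2.differentiableAt]
    ring
  d_t := by
    rw [A.d_of, A.eq_iff]
    exact Eventually.of_forall fun z => by simp
  ev_d a := by
    obtain ⟨f, hf, rfl⟩ := A.surj a
    rw [A.d_of, A.ev_of, zero_mul]
  isUnit_of_ev a h := by
    obtain ⟨f, hf, rfl⟩ := A.surj a
    exact A.isUnit_of_ne_zero hf (by rwa [A.ev_of] at h)
  ev_t := by rw [A.ev_of]
  t_pow_ne n h := by
    rw [A.of_pow, ← A.of_zero, A.eq_iff] at h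
    obtain ⟨z, hz, hz0⟩ := ((h.filter_mono nhdsWithin_le_nhds).and
      (eventually_mem_nhdsWithin (a := (0 : ℂ)) (s := {0}ᶜ))).exists
    exact pow_ne_zero n hz0 hz
  factor a ha := by
    obtain ⟨f, hf, rfl⟩ := A.surj a
    have hnz : ¬ ∀ᶠ z in 𝓝 (0 : ℂ), f z = 0 := fun h =>
      ha (by rw [← A.of_zero]; exact (A.eq_iff _ _).2 h)
    obtain ⟨n, g, hg, hg0, h⟩ := hf.exists_eventuallyEq_pow_smul_nonzero_iff.2 hnz
    refine ⟨n, A.of g hg, A.isUnit_of_ne_zero hg hg0, ?_⟩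
    rw [A.of_pow, A.of_mul, A.eq_iff]
    filter_upwards [h] with z hz
    simpa using hz

end AnalyticModel

/-- The germ of a holomorphic function. -/
def holGerm {l : Filter ℂ} (f : ℂ → ℂ) (hf : ∀ᶠ z in l, DifferentiableAt ℂ f z) : holRing l :=
  ⟨f, f, hf, rfl⟩

/-- The germ of a holomorphic section. -/
def secGerm {l : Filter ℂ} (f : ℂ → Fib) (hf : ∀ᶠ z in l, DifferentiableAt ℂ f z) : HolSec l :=
  ⟨f, f, hf, rfl⟩

theorem holGerm_eq_iff {l : Filter ℂ} {f g : ℂ → ℂ} {hf : ∀ᶠ z in l, DifferentiableAt ℂ f z}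
    {hg : ∀ᶠ z in l, DifferentiableAt ℂ g z} : holGerm f hf = holGerm g hg ↔ f =ᶠ[l] g :=
  Subtype.ext_iff.trans Germ.coe_eq

theorem exists_holGerm {l : Filter ℂ} (a : holRing l) : ∃ f hf, a = holGerm f hf := by
  obtain ⟨_, f, hf, rfl⟩ := a
  exact ⟨f, hf, rfl⟩

theorem exists_secGerm {l : Filter ℂ} (s : HolSec l) : ∃ f hf, s = secGerm f hf := by
  obtain ⟨_, f, hf, rfl⟩ := s
  exact ⟨f, hf, rfl⟩

theorem eventually_differentiableAt_of_analyticAt {g : ℂ → ℂ} (hg : AnalyticAt ℂ g 0) :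
    ∀ᶠ z in 𝓝 (0 : ℂ), DifferentiableAt ℂ g z :=
  hg.eventually_analyticAt.mono fun _ h => h.differentiableAt

/-- The local ring of the open curve at a point, as the ring of analytic germs. -/
def interiorModel : AnalyticModel (holRing (𝓝 (0 : ℂ))) (interiorConn.smul interiorCoord).d where
  of g hg := holGerm g (eventually_differentiableAt_of_analyticAt hg)
  surj a := by
    obtain ⟨f, hf, rfl⟩ := exists_holGerm a
    exact ⟨f, Complex.analyticAt_iff_eventually_differentiableAt.2 hf, rfl⟩
  eq_iff _ _ := holGerm_eq_iff
  of_zero := rfl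
  of_one := rfl
  of_add _ _ := rfl
  of_mul _ _ := rfl
  d_of _ := rfl

/-- The function `g(q)` in the local ring at a cusp. -/
def cuspGerm (g : ℂ → ℂ) (hg : AnalyticAt ℂ g 0) : cuspRing :=
  ⟨holGerm (fun z => g (qCoord z)) (by
    filter_upwards [tendsto_qCoord.eventually hg.eventually_analyticAt] with z hz
    exact hz.differentiableAt.comp z (deriv_qCoord z).differentiableAt), g, hg, rfl⟩

/-- As q → 0 with q ≠ 0, a logarithm of q tends to i∞, so properties along i∞ descend to a punctured
disc. -/
theorem eventually_punctured_of_iInfty {P : ℂ → Prop} (h : ∀ᶠ z in iInfty, P (qCoord z)) :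
    ∀ᶠ q in 𝓝[≠] (0 : ℂ), P q := by
  filter_upwards [(Function.Periodic.invQParam_tendsto one_pos).eventually h,
    eventually_mem_nhdsWithin] with q hq h0
  rwa [qCoord, Function.Periodic.qParam_right_inv one_ne_zero h0] at hq

/-- Agreement along i∞ only controls q ≠ 0; the identity theorem for analytic functions extends it
to q = 0. -/
theorem cuspGerm_eq_iff {f g : ℂ → ℂ} (hf : AnalyticAt ℂ f 0) (hg : AnalyticAt ℂ g 0) :
    cuspGerm f hf = cuspGerm g hg ↔ f =ᶠ[𝓝 0] g := by
  refine (Subtype.ext_iff.trans (Subtype.ext_iff.trans Germ.coe_eq)).trans ⟨fun h => ?_, fun h => ?_⟩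
  · exact (hf.frequently_eq_iff_eventually_eq hg).1 (eventually_punctured_of_iInfty (P := fun q => f q = g q) h).frequently
  · exact tendsto_qCoord.eventually h

/-- The local ring at a cusp, as the ring of analytic germs in `q`. -/
def cuspModel : AnalyticModel cuspRing cuspConn.d where
  of := cuspGerm
  surj a := by
    obtain ⟨g, hg, h⟩ := a.2
    exact ⟨g, hg, Subtype.ext (Subtype.ext h)⟩
  eq_iff := cuspGerm_eq_iff
  of_zero := rfl
  of_one := rfl
  of_add _ _ := rfl
  of_mul _ _ := rfl
  d_of {g} hg := by
    refine Subtype.ext (Subtype.ext (Germ.coe_eq.2 ?_))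
    filter_upwards [tendsto_qCoord.eventually hg.eventually_analyticAt] with z hz
    have h1 := (hz.differentiableAt.hasDerivAt.comp z (deriv_qCoord z)).deriv
    change (2 * Real.pi * Complex.I)⁻¹ • deriv (g ∘ qCoord) z = _
    rw [h1, smul_eq_mul]
    field_simp [Complex.two_pi_I_ne_zero]

theorem interiorModel_tendsto (a : holRing (𝓝 (0 : ℂ))) :
    (a : Germ (𝓝 (0 : ℂ)) ℂ).Tendsto (𝓝 (interiorModel.ev a)) := by
  obtain ⟨g, hg, rfl⟩ := interiorModel.surj a
  rw [interiorModel.ev_of]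
  exact hg.continuousAt

theorem cuspModel_tendsto (a : cuspRing) :
    ((a : holRing iInfty) : Germ iInfty ℂ).Tendsto (𝓝 (cuspModel.ev a)) := by
  obtain ⟨g, hg, rfl⟩ := cuspModel.surj a
  rw [cuspModel.ev_of]
  exact hg.continuousAt.tendsto.comp tendsto_qCoord

instance : NeBot iInfty :=
  comap_neBot_iff.2 fun s hs => by
    obtain ⟨a, ha⟩ := mem_atTop_sets.1 hs
    exact ⟨⟨0, a⟩, ha a le_rfl⟩

/-! ### Flat pairings of germs of sections -/

instance instModuleHolSec (l : Filter ℂ) : Module (holRing l) (HolSec l) := Submodule.module _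

instance instSMulHolSec (l : Filter ℂ) : SMul (holRing l) (HolSec l) :=
  (instModuleHolSec l).toSMul

theorem hasDerivAt_bilinForm (Q : LinearMap.BilinForm ℂ Fib) {f g : ℂ → Fib} {f' g' : Fib} {z : ℂ}
    (hf : HasDerivAt f f' z) (hg : HasDerivAt g g' z) :
    HasDerivAt (fun z => Q (f z) (g z)) (Q f' (g z) + Q (f z) g') z := by
  have h := Q.toContinuousBilinearMap.hasDerivAt_of_bilinear (u := f) (v := g) (x := z)
    (fun _ => hf) (fun _ => hg)
  rw [add_comm]
  exact h

/-- The pairing of two germs of sections. -/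
def secPair {l : Filter ℂ} (Q : LinearMap.BilinForm ℂ Fib) (s s' : HolSec l) : holRing l :=
  ⟨Germ.map₂ (fun x y => Q x y) (s : Germ l Fib) (s' : Germ l Fib), by
    obtain ⟨f, hf, h⟩ := s.2
    obtain ⟨g, hg, h'⟩ := s'.2
    rw [h, h']
    refine ⟨fun z => Q (f z) (g z), ?_, rfl⟩
    filter_upwards [hf, hg] with z h1 h2
    exact (hasDerivAt_bilinForm Q h1.hasDerivAt h2.hasDerivAt).differentiableAt⟩

/-- The form is constant in flat coordinates, so the product rule has no third term. The factor c
compares D with d/dz: t at a point of C, 1/(2πi) at a cusp. Values lie in `holRing l`, so that at a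
cusp a pairing need not be known to be a function of q. -/
theorem flatPairing_secPair {l : Filter ℂ} [OpenFilter l] {R : Type*} [CommRing R]
    [Module R (HolSec l)] (Q : LinearMap.BilinForm ℂ Fib) (D : CovDeriv R (HolSec l))
    (φ : R →+* holRing l) (c : holRing l) (hφ : ∀ (a : R) (s : HolSec l), a • s = φ a • s)
    (hD : ∀ s, D.toFun s = c • (flatConn l).toFun s)
    (hd : ∀ a, φ (D.d a) = c * (flatConn l).d (φ a)) :
    FlatPairing D φ (fun x => c * (flatConn l).d x) (secPair Q) := by
  have add_left : ∀ s s' r : HolSec l, secPair Q (s + s') r = secPair Q s r + secPair Q s' r := by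
    rintro ⟨_, f, hf, rfl⟩ ⟨_, g, hg, rfl⟩ ⟨_, h, hh, rfl⟩
    refine Subtype.ext (Germ.coe_eq.2 (Eventually.of_forall fun z => ?_))
    simp
  have add_right : ∀ r s s' : HolSec l, secPair Q r (s + s') = secPair Q r s + secPair Q r s' := by
    rintro ⟨_, f, hf, rfl⟩ ⟨_, g, hg, rfl⟩ ⟨_, h, hh, rfl⟩
    refine Subtype.ext (Germ.coe_eq.2 (Eventually.of_forall fun z => ?_))
    simp
  have smul_left : ∀ (a : holRing l) (s s' : HolSec l),
      secPair Q (a • s) s' = a * secPair Q s s' := by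
    rintro ⟨_, f, hf, rfl⟩ ⟨_, g, hg, rfl⟩ ⟨_, h, hh, rfl⟩
    refine Subtype.ext (Germ.coe_eq.2 (Eventually.of_forall fun z => ?_))
    simp
  have smul_right : ∀ (a : holRing l) (s s' : HolSec l),
      secPair Q s (a • s') = a * secPair Q s s' := by
    rintro ⟨_, f, hf, rfl⟩ ⟨_, g, hg, rfl⟩ ⟨_, h, hh, rfl⟩
    refine Subtype.ext (Germ.coe_eq.2 (Eventually.of_forall fun z => ?_))
    simp
  have leib : ∀ s s' : HolSec l, (flatConn l).d (secPair Q s s') =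
      secPair Q ((flatConn l).toFun s) s' + secPair Q s ((flatConn l).toFun s') := by
    rintro ⟨_, f, hf, rfl⟩ ⟨_, g, hg, rfl⟩
    refine Subtype.ext (Germ.coe_eq.2 ?_)
    filter_upwards [hf, hg] with z h1 h2
    exact (hasDerivAt_bilinForm Q h1.hasDerivAt h2.hasDerivAt).deriv
  have d_add : ∀ x y : holRing l,
      (flatConn l).d (x + y) = (flatConn l).d x + (flatConn l).d y := by
    rintro ⟨_, f, hf, rfl⟩ ⟨_, g, hg, rfl⟩
    refine Subtype.ext (Germ.coe_eq.2 ?_)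
    filter_upwards [hf, hg] with z h1 h2 using deriv_add h1 h2
  have d_mul : ∀ x y : holRing l,
      (flatConn l).d (x * y) = (flatConn l).d x * y + x * (flatConn l).d y := by
    rintro ⟨_, f, hf, rfl⟩ ⟨_, g, hg, rfl⟩
    refine Subtype.ext (Germ.coe_eq.2 ?_)
    filter_upwards [hf, hg] with z h1 h2 using deriv_mul h1 h2
  refine ⟨add_left, add_right, fun a s s' => ?_, fun a s s' => ?_, fun s s' => ?_, fun x y => ?_,
    fun a x => ?_, fun x hx => ?_⟩
  · rw [hφ, smul_left]
  · rw [hφ, smul_right]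
  · rw [leib, hD, hD, smul_left, smul_right, mul_add]
  · rw [d_add, mul_add]
  · rw [d_mul, hd]; ring
  · obtain ⟨f, hf, rfl⟩ := exists_holGerm x
    have h := Germ.coe_eq.1 (congrArg Subtype.val hx)
    refine Subtype.ext (Germ.coe_eq.2 ?_)
    filter_upwards [h] with z hz
    simpa using hz

theorem IsSelfDual.secPair_eq_zero {l : Filter ℂ} {R : Type*} [CommRing R] [Module R (HolSec l)]
    {D : CovDeriv R (HolSec l)} {V : Submodule R (HolSec l)} {H : HodgeFiltration D V}
    {T : Fib →ₗ[ℂ] Fib} {Q : LinearMap.BilinForm ℂ Fib} (h : IsSelfDual H T Q) :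
    ∀ p ≤ 4, ∀ s ∈ H.F p, ∀ s' ∈ H.F (4 - p), secPair Q s s' = 0 :=
  fun p hp s hs s' hs' => Subtype.ext (h.orthogonal p hp s hs s' hs')

/-! ### The interior stalk -/

/-- The logarithmic connection `t ∇`. -/
abbrev interiorLogConn : CovDeriv (holRing (𝓝 (0 : ℂ))) InteriorStalk :=
  interiorConn.smul interiorCoord

/-- A constant section. -/
def constSec (v : Fib) : InteriorStalk :=
  secGerm (fun _ => v) (Eventually.of_forall fun _ => differentiableAt_const v)

theorem interiorConn_constSec (v : Fib) : interiorConn.toFun (constSec v) = 0 :=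
  Subtype.ext (Germ.coe_eq.2 (Eventually.of_forall fun z => deriv_const z v))

theorem exists_eq_sum_constSec (s : InteriorStalk) :
    ∃ a : Fin 4 → holRing (𝓝 (0 : ℂ)), s = ∑ i, a i • constSec (Pi.single i 1) := by
  obtain ⟨f, hf, rfl⟩ := exists_secGerm s
  refine ⟨fun i => holGerm (fun z => f z i) (hf.mono fun z h => differentiableAt_pi.1 h i), ?_⟩
  rw [Fin.sum_univ_four]
  refine Subtype.ext (Germ.coe_eq.2 (Eventually.of_forall fun z => ?_))
  change f z = f z 0 • Pi.single 0 1 + f z 1 • Pi.single 1 1 + f z 2 • Pi.single 2 1 +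
    f z 3 • Pi.single 3 1
  funext i
  fin_cases i <;> simp

/-- Flat sections span, and each is a chain of length one with eigenvalue 0. -/
theorem interior_jordanSpanned : interiorLogConn.JordanSpanned interiorModel.logLocal ⊤ := by
  refine ⟨Set.range constSec, (eq_top_iff.2 fun s _ => ?_).symm, ?_⟩
  · obtain ⟨a, rfl⟩ := exists_eq_sum_constSec s
    exact sum_mem fun i _ => Submodule.smul_mem _ _ (Submodule.subset_span ⟨_, rfl⟩)
  · rintro _ ⟨v, rfl⟩
    refine ⟨0, le_rfl, one_pos, 0, by simp, fun j => if j = 0 then constSec v else 0, rfl,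
      fun _ => trivial, fun j => ?_, rfl⟩
    rcases j with _ | j
    · simp [CovDeriv.smul, interiorConn_constSec]
    · simp [CovDeriv.map_zero]

theorem interior_orthogonal_eq_zero {Q : LinearMap.BilinForm ℂ Fib} (hQ : Q.Nondegenerate)
    {ω : InteriorStalk} (h : ∀ s, secPair Q s ω = 0) : ω = 0 := by
  obtain ⟨f, hf, rfl⟩ := exists_secGerm ω
  have h1 : ∀ i : Fin 4, ∀ᶠ z in 𝓝 (0 : ℂ), Q (Pi.single i 1) (f z) = 0 := fun i =>
    Germ.coe_eq.1 (congrArg Subtype.val (h (constSec (Pi.single i 1))))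
  refine Subtype.ext (Germ.coe_eq.2 ?_)
  filter_upwards [eventually_all.2 h1] with z hz
  refine hQ.2 (f z) fun x => ?_
  have hx : x = ∑ i, x i • (Pi.single i 1 : Fib) := by
    rw [← pi_eq_sum_univ' x]
  rw [hx, map_sum, LinearMap.sum_apply]
  exact Finset.sum_eq_zero fun i _ => by rw [map_smul, LinearMap.smul_apply, hz i, smul_zero]

/-! ### The Deligne extension at a cusp -/

instance instModuleCuspRing : Module cuspRing (HolSec iInfty) := inferInstance

instance instSMulCuspRing : SMul cuspRing (HolSec iInfty) := instModuleCuspRing.toSMul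

section Deligne

variable (T : Fib →ₗ[ℂ] Fib) (α : ℝ)

/-- `ζ_α⁻¹ T - 1`. -/
def monodromyNil : Module.End ℂ Fib := (zetaRoot α)⁻¹ • T - 1

theorem zetaRoot_ne_zero : zetaRoot α ≠ 0 := Complex.exp_ne_zero _

theorem apply_eq_monodromyNil (x : Fib) : T x = zetaRoot α • (x + monodromyNil T α x) := by
  simp [monodromyNil, smul_smul, zetaRoot_ne_zero]

theorem mem_monodromyEigen_iff (v : Fib) : v ∈ monodromyEigen T α ↔
    monodromyNil T α (monodromyNil T α (monodromyNil T α (monodromyNil T α v))) = 0 := by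
  have h : (T - zetaRoot α • (1 : Module.End ℂ Fib) : Module.End ℂ Fib) =
      zetaRoot α • monodromyNil T α := by
    rw [monodromyNil, smul_sub, smul_smul, mul_inv_cancel₀ (zetaRoot_ne_zero α), one_smul]
  rw [monodromyEigen, h, LinearMap.mem_ker, smul_pow, LinearMap.smul_apply, smul_eq_zero]
  simp [zetaRoot_ne_zero, pow_succ]

theorem monodromyLog_apply (x : Fib) : monodromyLog T α x = monodromyNil T α x -
    (1 / 2 : ℂ) • monodromyNil T α (monodromyNil T α x) +
    (1 / 3 : ℂ) • monodromyNil T α (monodromyNil T α (monodromyNil T α x)) := by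
  have h : Finset.Icc (1 : ℕ) 3 = {1, 2, 3} := rfl
  rw [monodromyLog, h]
  change (∑ k ∈ ({1, 2, 3} : Finset ℕ), ((-1 : ℂ) ^ (k + 1) / (k : ℂ)) • monodromyNil T α ^ (k : ℕ)) x = _
  simp [pow_succ]
  module

variable {T α}

theorem monodromyLog_mem {v : Fib} (hv : v ∈ monodromyEigen T α) :
    monodromyLog T α v ∈ monodromyEigen T α := by
  rw [mem_monodromyEigen_iff] at hv ⊢
  simp [monodromyLog_apply, hv]

/-- With n⁴ = 0 on W_α, the logarithm n - n²/2 + n³/3 has square n² - n³, cube n³ and fourth power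
0. -/
theorem monodromyLog_iterate {v : Fib} (hv : v ∈ monodromyEigen T α) :
    monodromyLog T α (monodromyLog T α v) =
      monodromyNil T α (monodromyNil T α v) -
        monodromyNil T α (monodromyNil T α (monodromyNil T α v)) ∧
    monodromyLog T α (monodromyLog T α (monodromyLog T α v)) =
      monodromyNil T α (monodromyNil T α (monodromyNil T α v)) ∧
    monodromyLog T α (monodromyLog T α (monodromyLog T α (monodromyLog T α v))) = 0 := by
  rw [mem_monodromyEigen_iff] at hv
  have h1 : monodromyLog T α (monodromyLog T α v) =
      monodromyNil T α (monodromyNil T α v) -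
        monodromyNil T α (monodromyNil T α (monodromyNil T α v)) := by
    simp [monodromyLog_apply, hv]
    module
  have h2 : monodromyLog T α (monodromyLog T α (monodromyLog T α v)) =
      monodromyNil T α (monodromyNil T α (monodromyNil T α v)) := by
    rw [h1]
    simp [monodromyLog_apply, hv]
  refine ⟨h1, h2, ?_⟩
  rw [h2]
  simp [monodromyLog_apply, hv]

theorem deligneSection_eq (v : Fib) (z : ℂ) : deligneSection T α v z =
    Complex.exp (2 * Real.pi * Complex.I * α * z) • (v + z • monodromyLog T α v +
      (z ^ 2 / 2) • monodromyLog T α (monodromyLog T α v) +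
      (z ^ 3 / 6) • monodromyLog T α (monodromyLog T α (monodromyLog T α v))) := by
  simp [deligneSection, Finset.sum_range_succ, pow_succ, Nat.factorial]

theorem deligneSection_smul (c : ℂ) (v : Fib) (z : ℂ) :
    deligneSection T α (c • v) z = c • deligneSection T α v z := by
  simp only [deligneSection_eq, map_smul]
  module

theorem hasDerivAt_deligneSection {v : Fib} (hv : v ∈ monodromyEigen T α) (z : ℂ) :
    HasDerivAt (deligneSection T α v) ((2 * Real.pi * Complex.I * α) • deligneSection T α v z +
      deligneSection T α (monodromyLog T α v) z) z := by
  have h4 := (monodromyLog_iterate hv).2.2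
  have e1 : HasDerivAt (fun z : ℂ => Complex.exp (2 * Real.pi * Complex.I * α * z))
      (Complex.exp (2 * Real.pi * Complex.I * α * z) * (2 * Real.pi * Complex.I * α)) z := by
    simpa using ((hasDerivAt_id z).const_mul (2 * Real.pi * Complex.I * α : ℂ)).cexp
  have e2 : HasDerivAt (fun z : ℂ => z ^ 2 / 2) z z := by
    simpa using (hasDerivAt_pow 2 z).div_const 2
  have e3 : HasDerivAt (fun z : ℂ => z ^ 3 / 6) (z ^ 2 / 2) z := by
    convert! (hasDerivAt_pow 3 z).div_const 6 using 1
    push_cast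
    ring
  have e := e1.smul ((((hasDerivAt_const z v).add ((hasDerivAt_id z).smul_const
    (monodromyLog T α v))).add (e2.smul_const (monodromyLog T α (monodromyLog T α v)))).add
    (e3.smul_const (monodromyLog T α (monodromyLog T α (monodromyLog T α v)))))
  have hfun : deligneSection T α v = _ := funext fun z => deligneSection_eq v z
  rw [hfun]
  convert! e using 1
  rw [deligneSection_eq (monodromyLog T α v), h4]
  simp only [Pi.add_apply, id]
  module

/-- On W_α one has ζ_α exp(N_α) = T, which is exactly the effect of z ↦ z + 1. -/
theorem deligneSection_add_one {v : Fib} (hv : v ∈ monodromyEigen T α) (z : ℂ) :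
    deligneSection T α v (z + 1) = T (deligneSection T α v z) := by
  obtain ⟨h2, h3, -⟩ := monodromyLog_iterate hv
  rw [mem_monodromyEigen_iff] at hv
  have he : Complex.exp (2 * Real.pi * Complex.I * α * (z + 1)) =
      Complex.exp (2 * Real.pi * Complex.I * α * z) * zetaRoot α := by
    rw [zetaRoot, ← Complex.exp_add]
    ring_nf
  rw [deligneSection_eq, deligneSection_eq, h3, h2, he, apply_eq_monodromyNil T α,
    monodromyLog_apply]
  simp only [map_add, map_sub, map_smul, hv]
  module

variable (T α) in
/-- The germ of `exp (2πiαz + z N_α) v`. -/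
def deligneGerm (v : Fib) : HolSec iInfty :=
  secGerm (deligneSection T α v)
    (Eventually.of_forall fun z => differentiable_deligneSection T α v z)

theorem deligneGerm_mem (h0 : 0 ≤ α) (h1 : α < 1) {v : Fib} (hv : v ∈ monodromyEigen T α) :
    deligneGerm T α v ∈ deligneExtension T :=
  Submodule.subset_span ⟨α, h0, h1, v, hv, rfl⟩

theorem cuspGerm_smul_secGerm {g : ℂ → ℂ} (hg : AnalyticAt ℂ g 0) {f : ℂ → Fib}
    (hf : ∀ᶠ z in iInfty, DifferentiableAt ℂ f z) :
    ((cuspGerm g hg • secGerm f hf : HolSec iInfty) : Germ iInfty Fib) =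
      ((fun z => g (qCoord z) • f z : ℂ → Fib) : Germ iInfty Fib) := rfl

theorem cuspConn_deligneGerm {v : Fib} (hv : v ∈ monodromyEigen T α) :
    cuspConn.toFun (deligneGerm T α v) =
      cuspGerm (fun _ => (α : ℂ)) analyticAt_const • deligneGerm T α v +
        deligneGerm T α ((2 * Real.pi * Complex.I : ℂ)⁻¹ • monodromyLog T α v) := by
  refine Subtype.ext (Germ.coe_eq.2 (Eventually.of_forall fun z => ?_))
  change (2 * Real.pi * Complex.I : ℂ)⁻¹ • deriv (deligneSection T α v) z =
    (α : ℂ) • deligneSection T α v z +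
      deligneSection T α ((2 * Real.pi * Complex.I : ℂ)⁻¹ • monodromyLog T α v) z
  rw [(hasDerivAt_deligneSection hv z).deriv, deligneSection_smul, smul_add, smul_smul]
  congr 2
  field_simp [Complex.two_pi_I_ne_zero]

end Deligne

variable {T : Fib →ₗ[ℂ] Fib}

theorem deligneExtension_induction {P : HolSec iInfty → Prop}
    (gen : ∀ α : ℝ, 0 ≤ α → α < 1 → ∀ v ∈ monodromyEigen T α, P (deligneGerm T α v))
    (zero : P 0) (add : ∀ s s', P s → P s' → P (s + s'))
    (smul : ∀ (a : cuspRing) (s), s ∈ deligneExtension T → P s → P (a • s)) {s : HolSec iInfty}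
    (hs : s ∈ deligneExtension T) : P s := by
  induction hs using Submodule.span_induction with
  | mem s h =>
    obtain ⟨α, h0, h1, v, hv, h⟩ := h
    rw [show s = deligneGerm T α v from Subtype.ext h]
    exact gen α h0 h1 v hv
  | zero => exact zero
  | add s s' _ _ h h' => exact add s s' h h'
  | smul a s hs h => exact smul a s hs h

theorem cuspConn_mem {s : HolSec iInfty} (hs : s ∈ deligneExtension T) :
    cuspConn.toFun s ∈ deligneExtension T := by
  refine deligneExtension_induction (P := fun s => cuspConn.toFun s ∈ deligneExtension T)
    (fun α h0 h1 v hv => ?_) ?_ (fun s s' h h' => ?_) (fun a s hs h => ?_) hs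
  · rw [cuspConn_deligneGerm hv]
    exact add_mem (Submodule.smul_mem _ _ (deligneGerm_mem h0 h1 hv))
      (deligneGerm_mem h0 h1 (Submodule.smul_mem _ _ (monodromyLog_mem hv)))
  · rw [cuspConn.map_zero]; exact zero_mem _
  · rw [cuspConn.map_add]; exact add_mem h h'
  · rw [cuspConn.leibniz]
    exact add_mem (Submodule.smul_mem _ _ hs) (Submodule.smul_mem _ _ h)

/-- On the section attached to v, D acts as α plus the operator N_α/(2πi) applied to v. This
operator is nilpotent on W_α, so its iterates on v give the chain. -/
theorem cusp_jordanSpanned : cuspConn.JordanSpanned cuspModel.logLocal (deligneExtension T) := by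
  refine ⟨_, rfl, ?_⟩
  rintro s ⟨α, h0, h1, v, hv, h⟩
  let N : Fib → Fib := fun w => (2 * Real.pi * Complex.I : ℂ)⁻¹ • monodromyLog T α w
  have hN : ∀ j : ℕ, N^[j] v ∈ monodromyEigen T α := by
    intro j
    induction j with
    | zero => exact hv
    | succ j ih =>
      rw [Function.iterate_succ_apply']
      exact Submodule.smul_mem _ _ (monodromyLog_mem ih)
  refine ⟨α, h0, h1, cuspGerm (fun _ => (α : ℂ)) analyticAt_const,
    cuspModel.ev_of analyticAt_const,
    fun j => deligneGerm T α (N^[j] v), (Subtype.ext h).symm,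
    fun j => deligneGerm_mem h0 h1 (hN j), fun j => ?_, ?_⟩
  · dsimp only
    rw [cuspConn_deligneGerm (hN j), Function.iterate_succ_apply']
  · have : N^[4] v = 0 := by
      simp only [Function.iterate_succ, Function.iterate_zero, Function.comp_apply, id, N, map_smul,
        (monodromyLog_iterate hv).2.2, smul_zero]
    dsimp only
    rw [this]
    refine Subtype.ext (Germ.coe_eq.2 (Eventually.of_forall fun z => ?_))
    simp [deligneSection_eq]

theorem qCoord_add_one (z : ℂ) : qCoord (z + 1) = qCoord z := by
  simp only [qCoord, Function.Periodic.qParam, Complex.ofReal_one, div_one, mul_add, mul_one,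
    Complex.exp_add, Complex.exp_two_pi_mul_I]

/-- Sections of the Deligne extension are equivariant under the monodromy. -/
theorem exists_equivariant {s : HolSec iInfty} (hs : s ∈ deligneExtension T) :
    ∃ f : ℂ → Fib, (s : Germ iInfty Fib) = f ∧ ∀ᶠ z in iInfty, f (z + 1) = T (f z) := by
  refine deligneExtension_induction (P := fun s => ∃ f : ℂ → Fib, (s : Germ iInfty Fib) = f ∧
    ∀ᶠ z in iInfty, f (z + 1) = T (f z))
    (fun α h0 h1 v hv => ?_) ?_ (fun s s' h h' => ?_) (fun a s hs h => ?_) hs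
  · exact ⟨_, rfl, Eventually.of_forall fun z => deligneSection_add_one hv z⟩
  · exact ⟨0, rfl, Eventually.of_forall fun z => by simp⟩
  · obtain ⟨f, hf, h⟩ := h
    obtain ⟨g, hg, h'⟩ := h'
    refine ⟨f + g, by rw [Submodule.coe_add, hf, hg]; rfl, ?_⟩
    filter_upwards [h, h'] with z e1 e2
    simp [e1, e2]
  · obtain ⟨f, hf, h⟩ := h
    obtain ⟨g, hg, rfl⟩ := cuspModel.surj a
    obtain ⟨f', hf', rfl⟩ := exists_secGerm s
    refine ⟨fun z => g (qCoord z) • f z, ?_, ?_⟩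
    · refine (cuspGerm_smul_secGerm hg hf').trans (Germ.coe_eq.2 ?_)
      filter_upwards [Germ.coe_eq.1 hf] with z hz
      rw [hz]
    · filter_upwards [h] with z hz
      rw [qCoord_add_one, hz, map_smul]

/-! ### Local exponents and self-duality at a cusp -/

/-- The operator exp(zN_α) is unipotent: the section of N_α³v is a pure exponential times N_α³v, and
back substitution through N_α²v and N_α v reaches v. -/
theorem deligneSection_orthogonal {T : Fib →ₗ[ℂ] Fib} {α : ℝ} {Q : LinearMap.BilinForm ℂ Fib}
    {v : Fib} (hv : v ∈ monodromyEigen T α) {f : ℂ → Fib}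
    (h : ∀ v ∈ monodromyEigen T α, ∀ᶠ z in iInfty, Q (deligneSection T α v z) (f z) = 0) :
    ∀ᶠ z in iInfty, Q v (f z) = 0 := by
  have m1 := monodromyLog_mem hv
  have m2 := monodromyLog_mem m1
  have m3 := monodromyLog_mem m2
  have h4 := (monodromyLog_iterate hv).2.2
  filter_upwards [h _ hv, h _ m1, h _ m2, h _ m3] with z e0 e1 e2 e3
  simp only [deligneSection_eq, h4, map_smul, map_add, map_zero, LinearMap.smul_apply,
    LinearMap.add_apply, smul_eq_mul, mul_eq_zero, Complex.exp_ne_zero, false_or,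
    LinearMap.zero_apply, mul_zero, add_zero] at e0 e1 e2 e3
  rw [e3] at e2 e1 e0
  simp only [mul_zero, add_zero] at e2 e1 e0
  rw [e2] at e1 e0
  simp only [mul_zero, add_zero] at e1 e0
  rw [e1] at e0
  simpa using e0

theorem exists_zetaRoot_eq {μ : ℂ} (h : ‖μ‖ = 1) : ∃ α : ℝ, 0 ≤ α ∧ α < 1 ∧ zetaRoot α = μ := by
  refine ⟨Int.fract (μ.arg / (2 * Real.pi)), Int.fract_nonneg _, Int.fract_lt_one _, ?_⟩
  have hμ := Complex.norm_mul_exp_arg_mul_I μ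
  rw [h, Complex.ofReal_one, one_mul] at hμ
  rw [zetaRoot, ← hμ, Complex.exp_eq_exp_iff_exists_int]
  refine ⟨-⌊μ.arg / (2 * Real.pi)⌋, ?_⟩
  rw [hμ, Int.fract]
  push_cast
  have := Real.pi_ne_zero
  field_simp
  ring

/-- Since the eigenvalues have absolute value one, the spaces W_α with α in [0,1) span all flat
sections, so orthogonality to V is orthogonality to every constant vector. -/
theorem cusp_orthogonal_eq_zero {T : Fib →ₗ[ℂ] Fib} (hT : NonExpanding T)
    {Q : LinearMap.BilinForm ℂ Fib} (hQ : Q.Nondegenerate) {ω : HolSec iInfty}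
    (h : ∀ s ∈ deligneExtension T, secPair Q s ω = 0) : ω = 0 := by
  obtain ⟨f, hf, rfl⟩ := exists_secGerm ω
  have h1 : ∀ v : Fib, ∀ᶠ z in iInfty, Q v (f z) = 0 := by
    intro v
    have hv : v ∈ ⨆ μ : ℂ, Module.End.maxGenEigenspace T μ := by
      rw [Module.End.iSup_maxGenEigenspace_eq_top]
      trivial
    refine Submodule.iSup_induction _ (motive := fun v => ∀ᶠ z in iInfty, Q v (f z) = 0) hv
      (fun μ v hv => ?_) (by simp) (fun v w hv hw => ?_)
    · by_cases hμ : Module.End.HasEigenvalue T μ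
      · obtain ⟨α, h0, h1, rfl⟩ := exists_zetaRoot_eq (hT _ hμ)
        rw [Module.End.maxGenEigenspace_eq_genEigenspace_finrank,
          Module.End.mem_genEigenspace_nat, Module.finrank_fin_fun] at hv
        refine deligneSection_orthogonal (α := α) hv fun v hv => ?_
        exact Germ.coe_eq.1 (congrArg Subtype.val (h _ (deligneGerm_mem h0 h1 hv)))
      · have : Module.End.maxGenEigenspace T μ = ⊥ := by
          by_contra hne
          exact hμ (Module.End.HasUnifEigenvalue.lt (k := ⊤) zero_lt_one hne)
        rw [this, Submodule.mem_bot] at hv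
        simp [hv]
    · filter_upwards [hv, hw] with z e1 e2
      simp [e1, e2]
  refine Subtype.ext (Germ.coe_eq.2 ?_)
  filter_upwards [eventually_all.2 fun i : Fin 4 => h1 (Pi.single i 1)] with z hz
  refine hQ.2 (f z) fun x => ?_
  have hx : x = ∑ i, x i • (Pi.single i 1 : Fib) := by
    rw [← pi_eq_sum_univ' x]
  rw [hx, map_sum, LinearMap.sum_apply]
  exact Finset.sum_eq_zero fun i _ => by rw [map_smul, LinearMap.smul_apply, hz i, smul_zero]

theorem eventually_iInfty_iff {P : ℂ → Prop} :
    (∀ᶠ z in iInfty, P z) ↔ ∃ A : ℝ, ∀ z : ℂ, A < z.im → P z := by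
  rw [eventually_comap, eventually_atTop]
  constructor
  · rintro ⟨A, h⟩
    exact ⟨A, fun z hz => h z.im hz.le z rfl⟩
  · rintro ⟨A, h⟩
    exact ⟨A + 1, fun b hb z hz => h z (by linarith)⟩

/-- A single-valued nonzero solution of a first-order equation `q dY/dq = -(g/2) Y` with a regular
singularity has integral exponent. -/
theorem exists_int_of_periodic_solution {Y g : ℂ → ℂ} (hg : AnalyticAt ℂ g 0)
    (hY : ∀ᶠ z in iInfty, HasDerivAt Y (-(Real.pi * Complex.I * g (qCoord z) * Y z)) z)
    (hper : ∀ᶠ z in iInfty, Y (z + 1) = Y z) (hne : ¬ ∀ᶠ z in iInfty, Y z = 0) :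
    ∃ n : ℤ, g 0 = 2 * n := by
  have hd : AnalyticAt ℂ (dslope g 0) 0 := by
    obtain ⟨p, hp⟩ := hg
    exact ⟨_, hp.has_fpower_series_dslope_fslope⟩
  obtain ⟨ε, hε, hball⟩ := Metric.eventually_nhds_iff_ball.1 hd.eventually_analyticAt
  obtain ⟨G, hG⟩ := DifferentiableOn.isExactOn_ball (f := dslope g 0) (c := 0) (r := ε)
    fun z hz => (hball z hz).differentiableAt.differentiableWithinAt
  have hq := tendsto_qCoord.eventually (Metric.ball_mem_nhds (0 : ℂ) hε)
  -- An integrating factor: G is a primitive of (g(q) - g(0))/q, and d/dz of G(q)/2 is πi(g(q) -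
  -- g(0)), so E is locally constant.
  let E : ℂ → ℂ := fun z =>
    Complex.exp (Real.pi * Complex.I * g 0 * z + G (qCoord z) / 2) * Y z
  have hE : ∀ᶠ z in iInfty, HasDerivAt E 0 z := by
    filter_upwards [hY, hq] with z h1 h2
    have e1 := (hG _ h2).comp z (deriv_qCoord z)
    have e2 := ((((hasDerivAt_id z).const_mul (Real.pi * Complex.I * g 0)).add
      (e1.div_const 2)).cexp).mul h1
    convert! e2 using 1
    have e3 := sub_smul_dslope g 0 (qCoord z)
    rw [smul_eq_mul, sub_zero] at e3
    have e4 : g (qCoord z) = g 0 + qCoord z * dslope g 0 (qCoord z) := by rw [e3]; ring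
    rw [e4]
    simp only [Pi.add_apply, Function.comp_apply, id]
    ring
  obtain ⟨A, hA⟩ := eventually_iInfty_iff.1 (hE.and hper)
  have hS : IsOpen {z : ℂ | A < z.im} := isOpen_lt continuous_const Complex.continuous_im
  have hS' : IsPreconnected {z : ℂ | A < z.im} := (convex_halfSpace_im_gt A).isPreconnected
  obtain ⟨c, hc⟩ := hS.exists_is_const_of_deriv_eq_zero hS' (f := E)
    (fun z hz => (hA z hz).1.differentiableAt.differentiableWithinAt)
    (fun z hz => (hA z hz).1.deriv)
  obtain ⟨z, hz, hYz⟩ : ∃ z : ℂ, A < z.im ∧ Y z ≠ 0 := by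
    by_contra! hcon
    exact hne (eventually_iInfty_iff.2 ⟨A, hcon⟩)
  have h1 : E (z + 1) = E z := by
    rw [hc z hz, hc (z + 1) (by simpa using hz)]
  simp only [E, qCoord_add_one, (hA z hz).2] at h1
  -- E, q and Y all agree at z and z + 1, so the exponential factors agree, that is exp(πi g(0)) =
  -- 1.
  have h2 := mul_right_cancel₀ hYz h1
  obtain ⟨n, hn⟩ := Complex.exp_eq_exp_iff_exists_int.1 h2
  refine ⟨n, ?_⟩
  have h3 : (Real.pi * Complex.I : ℂ) * (g 0 - 2 * n) = 0 := by linear_combination hn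
  have h4 : (Real.pi * Complex.I : ℂ) ≠ 0 :=
    mul_ne_zero (Complex.ofReal_ne_zero.2 Real.pi_ne_zero) Complex.I_ne_zero
  exact sub_eq_zero.1 ((mul_eq_zero.1 h3).resolve_left h4)

/-! ### Kodaira–Spencer maps and local exponents -/

/-- The orders of vanishing of the Kodaira–Spencer maps of a self-dual filtration along a
logarithmic connection, in terms of the local exponents. -/
theorem IsLocalExponents.orders {R M K : Type*} [CommRing R] [AddCommGroup M] [Module R M]
    [CommRing K] {D : CovDeriv R M} {V : Submodule R M} (H : HodgeFiltration D V)
    (fr : HodgeFrame D H.F) (L : LogLocal R D.d) (hV : ∀ s ∈ V, D.toFun s ∈ V)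
    (hJ : D.JordanSpanned L V) {φ : R →+* K} {dK : K → K} {B : M → M → K}
    (P : FlatPairing D φ dK B) (orth : ∀ p ≤ 4, ∀ s ∈ H.F p, ∀ s' ∈ H.F (4 - p), B s s' = 0)
    (ht : ∀ x : K, φ L.t * x = 0 → x = 0) (hnd : ∀ ω, (∀ s ∈ V, B s ω = 0) → ω = 0)
    {l : Filter ℂ} [NeBot l] {ev : R →+* Germ l ℂ} (hev : ∀ a, (ev a).Tendsto (𝓝 (L.ev a)))
    {μ : Fin 4 → ℝ} (hμ : Monotone μ)
    (h : IsLocalExponents ev D (H.F 3) fun i => (μ i : ℂ)) :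
    ∃ (n0 n1 n2 : ℕ) (k : ℤ) (q : R), ∃ ω ∈ H.F 3, Ring.ord R (fr.a 2) = n0 ∧
      Ring.ord R (fr.a 1) = n1 ∧ Ring.ord R (fr.a 0) = n2 ∧ (n0 : ℤ) = ⌊μ 1⌋ - ⌊μ 0⌋ ∧
      (n1 : ℤ) = ⌊μ 2⌋ - ⌊μ 1⌋ ∧ (n2 : ℤ) = ⌊μ 3⌋ - ⌊μ 2⌋ ∧ μ 0 + μ 3 = μ 1 + μ 2 ∧
      L.ev q = -2 * (μ 0 + μ 3 + 2 * k : ℝ) ∧ B ω (D.toFun^[3] ω) ≠ 0 ∧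
      2 * dK (B ω (D.toFun^[3] ω)) = -(φ q * B ω (D.toFun^[3] ω)) := by
  obtain ⟨ω, hω, hc, Q, hQ, c, hcQ, k, hk⟩ := h
  have hcQ' : ∀ i, L.ev (Q i) = c i := by
    intro i
    obtain ⟨f, hf⟩ := Quotient.exists_rep (ev (Q i))
    have e1 := hev (Q i)
    have e2 := hcQ i
    rw [← hf] at e1 e2
    exact tendsto_nhds_unique (f := f) e1 e2
  obtain ⟨f, rfl⟩ := fr.coords_three H.F_four hω
  obtain ⟨y1, y2, y3⟩ := P.yukawa H.anti H.griffiths orth hω hQ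
  -- If Y vanished, ω would be orthogonal to all of V, hence zero by nondegeneracy, contradicting
  -- cyclicity.
  have hY : B (f • fr.e 3) (D.toFun^[3] (f • fr.e 3)) ≠ 0 := by
    intro h0
    rw [h0, neg_zero] at y1
    have h1 := P.orthogonal_of_yukawa_eq_zero L fr H.F_four H.anti H.griffiths orth ht hc y1
    rw [H.F_zero] at h1
    have := L.isDomain
    exact hc.ne_zero (0 : Fin 4) (hnd _ h1)
  have hsym := L.indicial_symmetric φ hY y3
  obtain ⟨m, n0, n1, n2, o0, o1, o2, r, hr0, hr1, hr⟩ := fr.exists_indicial_roots L H.F_four H.anti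
    H.griffiths (by rwa [H.F_zero]) (by rwa [H.F_zero]) hc hQ
  simp only [hcQ'] at hr hsym
  have hfl := floor_eq_of_prod_eq (f := fun i => μ i + k) (r := r)
    (b := ![(m : ℤ), m + n0, m + n0 + n1, m + n0 + n1 + n2])
    (fun i j hij => by simpa using hμ hij)
    (by
      rw [Fin.monotone_iff_le_succ]
      intro i
      fin_cases i <;> simp) hr0 hr1 (by
      intro y
      push_cast
      rw [← hk y, hr y, Fin.prod_univ_four]
      simp)
  have f0 := hfl 0
  have f1 := hfl 1
  have f2 := hfl 2
  have f3 := hfl 3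
  simp only [Int.floor_add_intCast, Matrix.cons_val] at f0 f1 f2 f3
  -- The cubic coefficient, isolated from the values at ±1 and ±2.
  have hc3 : c 3 = -2 * (((μ 0 + μ 1 + μ 2 + μ 3 + 4 * k) / 2 : ℝ) : ℂ) := by
    have e1 := hk 1
    have e2 := hk (-1)
    have e3 := hk 2
    have e4 := hk (-2)
    simp only [Fin.sum_univ_four, Fin.prod_univ_four, Fin.val_zero, Fin.val_one, Fin.val_two,
      show ((3 : Fin 4) : ℕ) = 3 from rfl] at e1 e2 e3 e4
    push_cast
    linear_combination (1 / 12) * (e3 - e4) - (1 / 6) * (e1 - e2)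
  obtain ⟨s1, s2⟩ := add_eq_of_symmetric hμ (k := k) (by simpa using hk) hc3 hsym
  refine ⟨n0, n1, n2, k, Q 3, _, hω, o0, o1, o2, by omega, by omega, by omega, by linarith, ?_, hY,
    y2⟩
  rw [hcQ', hc3, s1]

/-! ### Points of the open curve -/

namespace HodgeFiltration

variable {R M : Type*} [CommRing R] [AddCommGroup M] [Module R M]
  {D : CovDeriv R M} {V : Submodule R M}

/-- The same filtration, with the connection along a multiple of the vector field. -/
def smul (b : R) (H : HodgeFiltration D V) : HodgeFiltration (D.smul b) V where
  F := H.F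
  F_zero := H.F_zero
  F_four := H.F_four
  anti := H.anti
  free := H.free
  rank_one := H.rank_one
  griffiths p s hs := Submodule.smul_mem _ b (H.griffiths p s hs)

end HodgeFiltration

/-- The same frame, with the connection along a multiple of the vector field. -/
def HodgeFrame.smul {R M : Type*} [CommRing R] [AddCommGroup M] [Module R M]
    {D : CovDeriv R M} {F : ℕ → Submodule R M} (b : R) (fr : HodgeFrame D F) :
    HodgeFrame (D.smul b) F where
  e := fr.e
  mem := fr.mem
  gen := fr.gen
  indep := fr.indep
  a p := b * fr.a p
  a_spec p hp := by
    have h := Submodule.smul_mem _ b (fr.a_spec p hp)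
    rwa [smul_sub, smul_smul] at h

/-- For flat v, ∇(t^{n+1} v) = (n+1) t^n v with n+1 invertible, so the power of t can be lowered one
step at a time. -/
theorem interior_pow_smul {W : Submodule (holRing (𝓝 (0 : ℂ))) InteriorStalk}
    (hW : ∀ s ∈ W, interiorConn.toFun s ∈ W) (n : ℕ)
    (h : ∀ s : InteriorStalk, interiorModel.logLocal.t ^ n • s ∈ W) (s : InteriorStalk) :
    s ∈ W := by
  have := interiorModel.logLocal.isDomain
  induction n with
  | zero => simpa using h s
  | succ n ih =>
    refine ih fun s => ?_
    set t := interiorModel.logLocal.t with ht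
    obtain ⟨l, hl, hl0⟩ := interiorModel.logLocal.exists_logDeriv (n + 1) isUnit_one
    rw [mul_one, ← ht] at hl
    have hlu : IsUnit l := interiorModel.logLocal.isUnit_of_ev l (by
      rw [hl0]
      exact_mod_cast n.succ_ne_zero)
    have ht0 : t ≠ 0 := by simpa using interiorModel.logLocal.t_pow_ne 1
    have hd : interiorConn.d (t ^ (n + 1)) = l * t ^ n := by
      refine mul_left_cancel₀ ht0 ?_
      have : t * interiorConn.d (t ^ (n + 1)) = l * t ^ (n + 1) := hl
      rw [this]
      ring
    have hconst : ∀ v, t ^ n • constSec v ∈ W := by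
      intro v
      have h1 := hW _ (h (constSec v))
      rw [interiorConn.leibniz, interiorConn_constSec, smul_zero, add_zero, hd, mul_smul] at h1
      obtain ⟨l, rfl⟩ := hlu
      have h2 := Submodule.smul_mem W ((l⁻¹ : (holRing (𝓝 (0 : ℂ)))ˣ) : holRing (𝓝 (0 : ℂ))) h1
      rwa [smul_smul, Units.inv_mul, one_smul] at h2
    obtain ⟨a, rfl⟩ := exists_eq_sum_constSec s
    rw [Finset.smul_sum]
    refine sum_mem fun i _ => ?_
    rw [smul_comm]
    exact Submodule.smul_mem _ _ (hconst _)

/-- The span W of ω, …, ∇³ω is ∇-stable by the equation and contains some t^n V by cyclicity, so it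
is the whole stalk. Then e_0 lies in W, and modulo F¹ only ∇³ω contributes, so its leading
coefficient f a_2 a_1 a_0 is a unit. -/
theorem InteriorHodge.IsRegular.isUnit {H : InteriorHodge} (h : H.IsRegular)
    (fr : HodgeFrame interiorConn H.F) : IsUnit (fr.a 2) ∧ IsUnit (fr.a 1) ∧ IsUnit (fr.a 0) := by
  have := interiorModel.logLocal.isDomain
  obtain ⟨ω, hω, hc, P, hP⟩ := h
  obtain ⟨f, rfl⟩ := fr.coords_three H.F_four hω
  have hne := fr.ne_zero_of_cyclic H.F_four H.anti H.griffiths hc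
  obtain ⟨l1, l2, l3⟩ := fr.iterate_leading H.griffiths f
  set ω := f • fr.e 3 with hωdef
  set W := Submodule.span (holRing (𝓝 (0 : ℂ)))
    (Set.range fun i : Fin 4 => interiorConn.toFun^[(i : ℕ)] ω) with hWdef
  have hmem : ∀ i : Fin 4, interiorConn.toFun^[(i : ℕ)] ω ∈ W := fun i =>
    Submodule.subset_span ⟨i, rfl⟩
  have hmem4 : interiorConn.toFun^[4] ω ∈ W := by
    rw [eq_neg_of_add_eq_zero_left hP]
    exact neg_mem (sum_mem fun i _ => Submodule.smul_mem _ _ (hmem i))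
  have hW : ∀ s ∈ W, interiorConn.toFun s ∈ W := by
    intro s hs
    induction hs using Submodule.span_induction with
    | mem s hs =>
      obtain ⟨i, rfl⟩ := hs
      fin_cases i
      · exact hmem 1
      · change interiorConn.toFun (interiorConn.toFun^[1] ω) ∈ W
        rw [← Function.iterate_succ_apply' interiorConn.toFun]
        exact hmem 2
      · change interiorConn.toFun (interiorConn.toFun^[2] ω) ∈ W
        rw [← Function.iterate_succ_apply' interiorConn.toFun]
        exact hmem 3
      · change interiorConn.toFun (interiorConn.toFun^[3] ω) ∈ W
        rw [← Function.iterate_succ_apply' interiorConn.toFun]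
        exact hmem4
    | zero => rw [interiorConn.map_zero]; exact zero_mem _
    | add s s' _ _ h h' => rw [interiorConn.map_add]; exact add_mem h h'
    | smul a s hs h =>
      rw [interiorConn.leibniz]
      exact add_mem (Submodule.smul_mem _ _ hs) (Submodule.smul_mem _ _ h)
  -- Elimination without division: leading terms of elements of W recover F^p from F^{p+1} at the
  -- cost of the factor c'.
  have step : ∀ p < 4, ∀ c c' : holRing (𝓝 (0 : ℂ)), ∀ w ∈ W, w - c' • fr.e p ∈ H.F (p + 1) →
      (∀ s ∈ H.F (p + 1), c • s ∈ W) → ∀ s ∈ H.F p, (c * c') • s ∈ W := by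
    intro p hp c c' w hw hwp hcW s hs
    obtain ⟨r, y, hy, rfl⟩ := fr.exists_step p hp hs
    have h1 := Submodule.smul_mem W r (sub_mem (Submodule.smul_mem W c hw) (hcW _ hwp))
    have h2 := Submodule.smul_mem W c' (hcW _ hy)
    convert add_mem h1 h2 using 1
    module
  have c3 := step 3 (by omega) 1 f ω (hmem 0) (by rw [hωdef, sub_self]; exact zero_mem _) (by
    intro s hs
    rw [show s = 0 by simpa [H.F_four] using hs, smul_zero]
    exact zero_mem _)
  have c2 := step 2 (by omega) _ _ _ (hmem 1) l1 c3
  have c1 := step 1 (by omega) _ _ _ (hmem 2) l2 c2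
  have c0 := step 0 (by omega) _ _ _ (hmem 3) l3 c1
  have hall : ∀ s : InteriorStalk, s ∈ W := by
    have hne' : 1 * f * (f * fr.a 2) * (f * fr.a 2 * fr.a 1) * (f * fr.a 2 * fr.a 1 * fr.a 0) ≠ 0 := by
      simp only [mul_ne_zero_iff] at hne ⊢
      have := one_ne_zero (α := holRing (𝓝 (0 : ℂ)))
      tauto
    obtain ⟨n, u, hu, hnu⟩ := interiorModel.logLocal.factor _ hne'
    refine interior_pow_smul hW n fun s => ?_
    have h1 := c0 s (by rw [H.F_zero]; trivial)
    rw [hnu] at h1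
    obtain ⟨u, rfl⟩ := hu
    have h2 := Submodule.smul_mem W ((u⁻¹ : (holRing (𝓝 (0 : ℂ)))ˣ) : holRing (𝓝 (0 : ℂ))) h1
    rwa [smul_smul, mul_comm, mul_assoc, Units.mul_inv, mul_one] at h2
  obtain ⟨r, hr⟩ := (Submodule.mem_span_range_iff_exists_fun _).1 (hall (fr.e 0))
  rw [Fin.sum_univ_four] at hr
  have m0 : interiorConn.toFun^[((0 : Fin 4) : ℕ)] ω ∈ H.F 1 := H.anti _ (H.anti _ hω)
  have m1 : interiorConn.toFun^[((1 : Fin 4) : ℕ)] ω ∈ H.F 1 := H.anti _ (H.griffiths _ _ hω)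
  have m2 : interiorConn.toFun^[((2 : Fin 4) : ℕ)] ω ∈ H.F 1 :=
    H.griffiths _ _ (H.griffiths _ _ hω)
  have hu : 1 - r 3 * (f * fr.a 2 * fr.a 1 * fr.a 0) = 0 := by
    refine fr.indep 0 (by omega) _ ?_
    have h1 := add_mem (add_mem (add_mem (Submodule.smul_mem _ (r 0) m0)
      (Submodule.smul_mem _ (r 1) m1)) (Submodule.smul_mem _ (r 2) m2))
      (Submodule.smul_mem _ (r 3) l3)
    convert h1 using 1
    rw [sub_smul, one_smul]
    nth_rewrite 1 [← hr]
    rw [smul_sub, mul_smul (r 3)]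
    exact add_sub_assoc _ _ _
  have hu' : IsUnit (f * fr.a 2 * fr.a 1 * fr.a 0) :=
    IsUnit.of_mul_eq_one (r 3) (by rw [mul_comm]; exact (sub_eq_zero.1 hu).symm)
  simp only [IsUnit.mul_iff] at hu'
  tauto

/-- For `t∇` every a_p is multiplied by t, which raises its order by one; this accounts for the -1.
The symmetry of the exponents replaces the last gap by the first. -/
theorem InteriorHodge.orders {H : InteriorHodge} {Q : LinearMap.BilinForm ℂ Fib}
    (hQ : IsSelfDual H LinearMap.id Q) {μ : Fin 4 → ℤ} (hμ : StrictMono μ)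
    (h : H.Exponents fun i => (μ i : ℂ)) :
    (∃ n : ℕ, cokerLength H.tau0 = n ∧ (n : ℤ) = μ 1 - μ 0 - 1) ∧
    (∃ n : ℕ, cokerLength H.tau1 = n ∧ (n : ℤ) = μ 2 - μ 1 - 1) ∧
    (∃ n : ℕ, cokerLength H.tau2 = n ∧ (n : ℤ) = μ 1 - μ 0 - 1) := by
  have := interiorModel.logLocal.isDomain
  obtain ⟨fr⟩ := H.exists_frame
  have hP : FlatPairing interiorLogConn (RingHom.id _) (fun x => interiorCoord * interiorConn.d x)
      (secPair Q) :=
    flatPairing_secPair Q interiorLogConn (RingHom.id _) interiorCoord (fun _ _ => rfl)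
      (fun _ => rfl) fun _ => rfl
  have ht0 : interiorModel.logLocal.t ≠ 0 := by simpa using interiorModel.logLocal.t_pow_ne 1
  obtain ⟨n0, n1, n2, k, q, ω, -, o0, o1, o2, e0, e1, e2, es, -, -, -⟩ :=
    IsLocalExponents.orders (H.smul interiorCoord) (fr.smul interiorCoord) interiorModel.logLocal
      (fun _ _ => trivial) interior_jordanSpanned hP hQ.secPair_eq_zero
      (fun x hx => (mul_eq_zero.1 hx).resolve_left ht0)
      (fun ω hω => interior_orthogonal_eq_zero hQ.nondegenerate fun s => hω s trivial)
      interiorModel_tendsto (μ := fun i => (μ i : ℝ))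
      (Int.cast_mono.comp hμ.monotone) (by
        simp only [Complex.ofReal_intCast]
        exact h)
  have key : ∀ (p n : ℕ), Ring.ord (holRing (𝓝 (0 : ℂ))) ((fr.smul interiorCoord).a p) = n →
      ∃ n' : ℕ, Ring.ord (holRing (𝓝 (0 : ℂ))) (fr.a p) = n' ∧ (n : ℤ) = n' + 1 := by
    intro p n hn
    have h1 : Ring.ord (holRing (𝓝 (0 : ℂ))) (interiorModel.logLocal.t * fr.a p) = n := hn
    rw [Ring.ord_mul' _ (mem_nonZeroDivisors_of_ne_zero ht0), LogLocal.ord_t] at h1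
    cases h2 : Ring.ord (holRing (𝓝 (0 : ℂ))) (fr.a p) with
    | top => rw [h2] at h1; simp at h1
    | coe x =>
      rw [h2] at h1
      refine ⟨x, rfl, ?_⟩
      have : 1 + x = n := by exact_mod_cast h1
      omega
  simp only [Int.floor_intCast] at e0 e1 e2
  have es' : μ 0 + μ 3 = μ 1 + μ 2 := by exact_mod_cast es
  obtain ⟨n0', o0', f0⟩ := key 2 n0 o0
  obtain ⟨n1', o1', f1⟩ := key 1 n1 o1
  obtain ⟨n2', o2', f2⟩ := key 0 n2 o2
  refine ⟨⟨n0', ?_, by omega⟩, ⟨n1', ?_, by omega⟩, ⟨n2', ?_, by omega⟩⟩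
  · rw [← o0']; exact H.cokerLength_kodairaSpencer fr (by omega)
  · rw [← o1']; exact H.cokerLength_kodairaSpencer fr (by omega)
  · rw [← o2']; exact H.cokerLength_kodairaSpencer fr (by omega)

/-! ### Cusps -/

/-- The Yukawa coupling at a cusp is single-valued, so that its exponent is an integer. -/
theorem cusp_exponent_int {T : Fib →ₗ[ℂ] Fib} {Q : LinearMap.BilinForm ℂ Fib}
    (hQ : ∀ x y, Q (T x) (T y) = Q x y) {s s' : HolSec iInfty} (hs : s ∈ deligneExtension T)
    (hs' : s' ∈ deligneExtension T) {q : cuspRing} (hne : secPair Q s s' ≠ 0)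
    (h : 2 * (holGerm (fun _ => (2 * Real.pi * Complex.I : ℂ)⁻¹)
      (Eventually.of_forall fun _ => differentiableAt_const _) *
        (flatConn iInfty).d (secPair Q s s')) = -((q : holRing iInfty) * secPair Q s s')) :
    ∃ n : ℤ, cuspModel.ev q = 2 * n := by
  obtain ⟨g, hg, rfl⟩ := cuspModel.surj q
  rw [cuspModel.ev_of]
  obtain ⟨f, hf, ef⟩ := exists_equivariant hs
  obtain ⟨f', hf', ef'⟩ := exists_equivariant hs'
  have hY : ((secPair Q s s' : holRing iInfty) : Germ iInfty ℂ) =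
      ((fun z => Q (f z) (f' z) : ℂ → ℂ) : Germ iInfty ℂ) := by
    change Germ.map₂ (fun x y => Q x y) (s : Germ iInfty Fib) (s' : Germ iInfty Fib) = _
    rw [hf, hf']
    rfl
  obtain ⟨Y, hYd, hYs⟩ := exists_holGerm (secPair Q s s')
  rw [hYs] at h hY hne
  have hY' : Y =ᶠ[iInfty] fun z => Q (f z) (f' z) := Germ.coe_eq.1 hY
  have h' := Germ.coe_eq.1 (congrArg Subtype.val h)
  refine exists_int_of_periodic_solution (Y := Y) hg ?_ ?_ ?_
  · filter_upwards [hYd, h'] with z e1 e2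
    have e3 : 2 * ((2 * Real.pi * Complex.I : ℂ)⁻¹ * deriv Y z) = -(g (qCoord z) * Y z) := e2
    convert! e1.hasDerivAt using 1
    have := Complex.two_pi_I_ne_zero
    field_simp at e3
    rw [e3]
  · have hshift : Tendsto (fun z : ℂ => z + 1) iInfty iInfty := by
      refine tendsto_comap_iff.2 ?_
      have : Complex.im ∘ (fun z : ℂ => z + 1) = Complex.im := by
        funext z
        simp
      rw [this]
      exact tendsto_comap
    filter_upwards [hY', hshift.eventually hY', ef, ef'] with z e1 e2 e3 e4
    rw [e1, e2, e3, e4, hQ]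
  · intro h0
    exact hne (Subtype.ext (Germ.coe_eq.2 h0))

theorem CuspHodge.orders {T : Fib →ₗ[ℂ] Fib} (hT : NonExpanding T) {H : CuspHodge T}
    {Q : LinearMap.BilinForm ℂ Fib} (hQ : IsSelfDual H T Q) {μ : Fin 4 → ℝ} (hμ : Monotone μ)
    (h : H.Exponents fun i => (μ i : ℂ)) :
    (∃ n : ℕ, cokerLength H.tau0 = n ∧ (n : ℤ) = ⌊μ 1⌋ - ⌊μ 0⌋) ∧
    (∃ n : ℕ, cokerLength H.tau1 = n ∧ (n : ℤ) = ⌊μ 2⌋ - ⌊μ 1⌋) ∧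
    (∃ n : ℕ, cokerLength H.tau2 = n ∧ (n : ℤ) = ⌈μ 1⌉ - ⌈μ 0⌉) := by
  have := cuspModel.logLocal.isDomain
  obtain ⟨fr⟩ := H.exists_frame
  have hP := flatPairing_secPair Q cuspConn cuspRing.subtype
    (holGerm (fun _ => (2 * Real.pi * Complex.I : ℂ)⁻¹)
      (Eventually.of_forall fun _ => differentiableAt_const _)) (fun _ _ => rfl)
    (by
      rintro ⟨_, f, hf, rfl⟩
      rfl) (by
      rintro ⟨⟨_, f, hf, rfl⟩, ha⟩
      rfl)
  have hV : ∀ s ∈ deligneExtension T, cuspConn.toFun s ∈ deligneExtension T :=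
    fun s hs => cuspConn_mem hs
  obtain ⟨n0, n1, n2, k, q, ω, hω, o0, o1, o2, e0, e1, e2, es, eq, hY, hd⟩ :=
    IsLocalExponents.orders H fr cuspModel.logLocal hV cusp_jordanSpanned hP hQ.secPair_eq_zero
      (fun x hx => by
        obtain ⟨f, hf, rfl⟩ := exists_holGerm x
        have h1 := Germ.coe_eq.1 (congrArg Subtype.val hx)
        refine Subtype.ext (Germ.coe_eq.2 ?_)
        filter_upwards [h1] with z hz
        have h2 : qCoord z * f z = 0 := hz
        exact (mul_eq_zero.1 h2).resolve_left (Function.Periodic.qParam_ne_zero z))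
      (fun ω hω => cusp_orthogonal_eq_zero hT hQ.nondegenerate hω)
      cuspModel_tendsto hμ h
  have hω0 : ω ∈ deligneExtension T := by
    rw [← H.F_zero]
    exact H.anti _ (H.anti _ (H.anti _ hω))
  have hω3 : cuspConn.toFun^[3] ω ∈ deligneExtension T := by
    simp only [Function.iterate_succ_apply', Function.iterate_zero, id]
    exact hV _ (hV _ (hV _ hω0))
  obtain ⟨n, hn⟩ := cusp_exponent_int hQ.invariant hω0 hω3 hY hd
  -- Single-valuedness of Y makes Q_3(0) an even integer, so μ_3 and μ_2 are an integer minus μ_0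
  -- and μ_1; negation exchanges floor and ceiling.
  have hsum : μ 0 + μ 3 = ((-n - 2 * k : ℤ) : ℝ) := by
    have h1 : cuspModel.logLocal.ev q = 2 * n := hn
    rw [h1] at eq
    have h2 : (2 * n : ℝ) = -2 * (μ 0 + μ 3 + 2 * k) := by exact_mod_cast eq
    push_cast
    linarith
  have c3 : ⌊μ 3⌋ = -n - 2 * k - ⌈μ 0⌉ := by
    rw [show μ 3 = ((-n - 2 * k : ℤ) : ℝ) + -μ 0 by linarith, Int.floor_intCast_add, Int.floor_neg]
    ring
  have c2 : ⌊μ 2⌋ = -n - 2 * k - ⌈μ 1⌉ := by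
    rw [show μ 2 = ((-n - 2 * k : ℤ) : ℝ) + -μ 1 by linarith, Int.floor_intCast_add, Int.floor_neg]
    ring
  refine ⟨⟨n0, ?_, e0⟩, ⟨n1, ?_, e1⟩, ⟨n2, ?_, by omega⟩⟩
  · rw [← o0]; exact H.cokerLength_kodairaSpencer fr (by omega)
  · rw [← o1]; exact H.cokerLength_kodairaSpencer fr (by omega)
  · rw [← o2]; exact H.cokerLength_kodairaSpencer fr (by omega)

theorem ceil_sub_ceil_eq {x y : ℝ} (h : (∃ m : ℤ, x = m) ↔ ∃ m : ℤ, y = m) :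
    ⌈y⌉ - ⌈x⌉ = ⌊y⌋ - ⌊x⌋ := by
  by_cases hx : ∃ m : ℤ, x = m
  · obtain ⟨m, rfl⟩ := hx
    obtain ⟨m', rfl⟩ := h.1 ⟨m, rfl⟩
    simp
  · have key : ∀ z : ℝ, (¬ ∃ m : ℤ, z = m) → ⌈z⌉ = ⌊z⌋ + 1 := by
      intro z hz
      rw [Int.ceil_eq_iff]
      push_cast
      refine ⟨?_, (Int.lt_floor_add_one z).le⟩
      rw [add_sub_cancel_right]
      exact lt_of_le_of_ne (Int.floor_le z) fun h => hz ⟨_, h.symm⟩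
    rw [key x hx, key y fun hy => hx (h.2 hy)]
    ring

end

theorem lemma6p3 :
    -- regular points of the open curve
    (∀ (H : InteriorHodge) (Q : LinearMap.BilinForm ℂ Fib), IsSelfDual H LinearMap.id Q →
      H.IsRegular →
        Function.Bijective H.tau0 ∧ Function.Bijective H.tau1 ∧ Function.Bijective H.tau2) ∧
    -- points of the open curve with distinct integral exponents
    (∀ (H : InteriorHodge) (Q : LinearMap.BilinForm ℂ Fib), IsSelfDual H LinearMap.id Q →
      ∀ μ : Fin 4 → ℤ, StrictMono μ → H.Exponents (fun i => (μ i : ℂ)) →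
        (∃ n : ℕ, cokerLength H.tau0 = n ∧ (n : ℤ) = μ 1 - μ 0 - 1) ∧
        (∃ n : ℕ, cokerLength H.tau1 = n ∧ (n : ℤ) = μ 2 - μ 1 - 1) ∧
        (∃ n : ℕ, cokerLength H.tau2 = n ∧ (n : ℤ) = μ 1 - μ 0 - 1)) ∧
    -- cusps
    (∀ T : Fib →ₗ[ℂ] Fib, NonExpanding T →
      ∀ (H : CuspHodge T) (Q : LinearMap.BilinForm ℂ Fib), IsSelfDual H T Q →
      ∀ μ : Fin 4 → ℝ, Monotone μ → H.Exponents (fun i => (μ i : ℂ)) →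
        (∃ n : ℕ, cokerLength H.tau0 = n ∧ (n : ℤ) = ⌊μ 1⌋ - ⌊μ 0⌋) ∧
        (∃ n : ℕ, cokerLength H.tau1 = n ∧ (n : ℤ) = ⌊μ 2⌋ - ⌊μ 1⌋) ∧
        (∃ n : ℕ, cokerLength H.tau2 = n ∧ (n : ℤ) = ⌈μ 1⌉ - ⌈μ 0⌉ ∧
          (((∃ m : ℤ, μ 0 = m) ↔ (∃ m : ℤ, μ 1 = m)) → (n : ℤ) = ⌊μ 1⌋ - ⌊μ 0⌋))) := by
  refine ⟨fun H Q _ hreg => ?_, fun H Q hQ μ hμ h => InteriorHodge.orders hQ hμ h,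
    fun T hT H Q hQ μ hμ h => ?_⟩
  · have := interiorModel.logLocal.isDomain
    obtain ⟨fr⟩ := H.exists_frame
    obtain ⟨h2, h1, h0⟩ := hreg.isUnit fr
    exact ⟨H.bijective_kodairaSpencer fr (by omega) h2, H.bijective_kodairaSpencer fr (by omega) h1,
      H.bijective_kodairaSpencer fr (by omega) h0⟩
  · obtain ⟨h0, h1, n, h2, hn⟩ := CuspHodge.orders hT hQ hμ h
    exact ⟨h0, h1, n, h2, hn, fun hint => hn.trans (ceil_sub_ceil_eq hint)⟩
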